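/- Let $N\ge 1$ be an integer, let $\omega\in\mathbb{C}$ be a primitive $N$-th root of unity and let $\mathbb{Z}_N=\mathbb{Z}/N\mathbb{Z}$. A $\mathbb{Z}_N$-$C^*$-algebra is a unital $C^*$-algebra $X$ with a coaction $\rho\colon X\to X\otimes C(\mathbb{Z}_N)=C(\mathbb{Z}_N,X)$, $x\mapsto(t\mapsto\rho_t(x))$, that is, a unital $*$-homomorphism with $(\rho\otimes\mathrm{id})\rho=(\mathrm{id}\otimes\Delta_{\mathbb{Z}_N})\rho$ for which $\rho(X)(1\otimes C(\mathbb{Z}_N))$ spans a dense subspace of $X\otimes C(\mathbb{Z}_N)$; an equivariant morphism is a unital $*$-homomorphism $\phi$ with $\rho_t\phi=\phi\rho_t$ for all $t$. The element $x$ has degree $d$ if $\rho_t(x)=\omega^{td}x$ for all $t$. For $\mathbb{Z}_N$-$C^*$-algebras $X$ and $Y$, represented faithfully and equivariantly on Hilbert spaces $\mathcal{L}^X$ and $\mathcal{L}^Y$ with unitary representations of $\mathbb{Z}_N$, the braided tensor product $X\boxtimes_R Y$ is the $C^*$-subalgebra of $\mathbb{B}(\mathcal{L}^X\otimes\mathcal{L}^Y)$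 generated by the products $j_1(x)j_2(y)$, $x\in X$, $y\in Y$, where $j_1(x)=x\otimes 1$, $j_2(y)=c^{-1}(y\otimes 1)c$ and $c\colon\mathcal{L}^X\otimes\mathcal{L}^Y\to\mathcal{L}^Y\otimes\mathcal{L}^X$ is the unitary with $c(\xi\otimes\eta)=\omega^{mn}\,\eta\otimes\xi$ for $\xi,\eta$ of degrees $m,n$. It does not depend on the choice of the representations, and $j_1(x)j_2(y)=\omega^{\deg x\deg y}j_2(y)j_1(x)$ for homogeneous $x,y$. For equivariant morphisms $\phi\colon X\to X'$ and $\psi\colon Y\to Y'$, the morphism $\phi\boxtimes_R\psi\colon X\boxtimes_R Y\to X'\boxtimes_R Y'$ maps $j_1(x)j_2(y)$ to $j_1(\phi(x))j_2(\psi(y))$. Let $C(S_N^+(R))$ be the universal unital $C^*$-algebra with generators $q_{ij}$, $i,j\in\mathbb{Z}_N$, and the following relations, for all $i,j,k\in\mathbb{Z}_N$: (1) $q_{0i}=q_{i0}=\delta_{i0}$; (2) $q_{ij}^*=\omega^{-i(i-j)}q_{-i,-j}$; (3) $q_{k,i+j}=\sum_{l\in\mathbb{Z}_N}\omega^{-l(i-k+l)}q_{k-l,i}\,q_{lj}$;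 (4) $q_{i+j,k}=\sum_{l\in\mathbb{Z}_N}\omega^{-i(l-j)}q_{jl}\,q_{i,k-l}$. Let $C(U_N^+(R))$ be the universal unital $C^*$-algebra with generators $u_{ij}$, $i,j\in\mathbb{Z}_N$, subject to the relations that the matrices $u=(u_{ij})$ and $\overline{u}_R=(\omega^{-i(j-i)}u_{ij}^*)$ are unitary. Both are $\mathbb{Z}_N$-$C^*$-algebras through $\rho_t(q_{ij})=\omega^{t(j-i)}q_{ij}$ and $\rho_t(u_{ij})=\omega^{t(j-i)}u_{ij}$, and they carry the comultiplications $\Delta_S\colon C(S_N^+(R))\to C(S_N^+(R))\boxtimes_R C(S_N^+(R))$ and $\Delta_U\colon C(U_N^+(R))\to C(U_N^+(R))\boxtimes_R C(U_N^+(R))$ with $\Delta_S(q_{ij})=\sum_k j_1(q_{ik})j_2(q_{kj})$ and $\Delta_U(u_{ij})=\sum_k j_1(u_{ik})j_2(u_{kj})$. Theorem. The matrices $q=(q_{ij})$ and $\overline{q}_R=(\omega^{-i(j-i)}q_{ij}^*)$ over $C(S_N^+(R))$ are unitary. There is a unique $\mathbb{Z}_N$-equivariant Hopf $*$-homomorphism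 $\phi\colon C(U_N^+(R))\to C(S_N^+(R))$, that is, a unique equivariant morphism $\phi$ with $\Delta_S\circ\phi=(\phi\boxtimes_R\phi)\circ\Delta_U$, such that $\phi(u_{ij})=q_{ij}$ for all $i,j\in\mathbb{Z}_N$. Moreover, $\phi$ is surjective, so that $S_N^+(R)$ is a quantum subgroup, in the braided sense, of $U_N^+(R)$. -/

import Mathlib

noncomputable section

namespace Anyonic

open scoped TensorProduct ComplexConjugate
open UniformSpace

/-! ### The free unital `*`-algebra on a set of generators -/

/-- The free unital complex algebra on `G` and a disjoint copy of `G`; the generator `Sum.inr g`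
plays the role of the adjoint of the generator `Sum.inl g`. -/
def FreeStarAlg (G : Type*) : Type _ := FreeAlgebra ℂ (G ⊕ G)

namespace FreeStarAlg

variable {G : Type*}

instance : Ring (FreeStarAlg G) := inferInstanceAs (Ring (FreeAlgebra ℂ (G ⊕ G)))
instance : Algebra ℂ (FreeStarAlg G) := inferInstanceAs (Algebra ℂ (FreeAlgebra ℂ (G ⊕ G)))

/-- The generators and their formal adjoints. -/
def letter (z : G ⊕ G) : FreeStarAlg G := FreeAlgebra.ι ℂ z

/-- The generators. -/
def gen (g : G) : FreeStarAlg G := letter (Sum.inl g)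

theorem induction {P : FreeStarAlg G → Prop} (h₀ : ∀ r : ℂ, P (algebraMap ℂ _ r))
    (h₁ : ∀ z, P (letter z)) (hm : ∀ a b, P a → P b → P (a * b))
    (ha : ∀ a b, P a → P b → P (a + b)) (a : FreeStarAlg G) : P a :=
  FreeAlgebra.induction ℂ (G ⊕ G) (motive := P) h₀ h₁ hm ha a

/-- The opposite of the free algebra, with complex scalars acting through complex conjugation. -/
def ConjOp (G : Type*) : Type _ := (FreeStarAlg G)ᵐᵒᵖ

instance : Ring (ConjOp G) := inferInstanceAs (Ring (FreeStarAlg G)ᵐᵒᵖ)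
instance : Algebra ℂ (ConjOp G) :=
  RingHom.toAlgebra' ((algebraMap ℂ (FreeStarAlg G)ᵐᵒᵖ).comp (starRingEnd ℂ))
    fun c x => Algebra.commutes (A := (FreeStarAlg G)ᵐᵒᵖ) (conj c) x

/-- The conjugate linear antimultiplicative map that exchanges each generator with its adjoint. -/
def starAux : FreeStarAlg G →ₐ[ℂ] ConjOp G :=
  FreeAlgebra.lift ℂ fun z => (MulOpposite.op (letter z.swap) : (FreeStarAlg G)ᵐᵒᵖ)

instance : Star (FreeStarAlg G) :=
  ⟨fun a => MulOpposite.unop (show (FreeStarAlg G)ᵐᵒᵖ from starAux a)⟩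

theorem star_letter (z : G ⊕ G) : star (letter z) = letter z.swap :=
  congrArg MulOpposite.unop
    (FreeAlgebra.lift_ι_apply (R := ℂ) (A := ConjOp G)
      (fun z : G ⊕ G => (MulOpposite.op (letter z.swap : FreeStarAlg G) : (FreeStarAlg G)ᵐᵒᵖ)) z)

theorem star_algebraMap' (c : ℂ) :
    star (algebraMap ℂ (FreeStarAlg G) c) = algebraMap ℂ (FreeStarAlg G) (conj c) :=
  congrArg MulOpposite.unop ((starAux (G := G)).commutes c)

instance : StarRing (FreeStarAlg G) where
  star_mul a b := congrArg MulOpposite.unop (map_mul (starAux (G := G)) a b)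
  star_add a b := congrArg MulOpposite.unop (map_add (starAux (G := G)) a b)
  star_involutive a := by
    have hm : ∀ a b : FreeStarAlg G, star (a * b) = star b * star a := fun a b =>
      congrArg MulOpposite.unop (map_mul (starAux (G := G)) a b)
    have ha : ∀ a b : FreeStarAlg G, star (a + b) = star a + star b := fun a b =>
      congrArg MulOpposite.unop (map_add (starAux (G := G)) a b)
    induction a using induction with
    | h₀ r => rw [star_algebraMap', star_algebraMap', Complex.conj_conj]
    | h₁ z => rw [star_letter, star_letter, Sum.swap_swap]
    | hm a b h₁ h₂ => rw [hm, hm, h₁, h₂]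
    | ha a b h₁ h₂ => rw [ha, ha, h₁, h₂]

instance : StarModule ℂ (FreeStarAlg G) where
  star_smul c a := by
    rw [Algebra.smul_def, star_mul, star_algebraMap', Algebra.smul_def]
    exact (Algebra.commutes _ _).symm

section lift

variable {B : Type*} [Ring B] [StarRing B] [Algebra ℂ B]

/-- The algebra homomorphism with given values on the generators and on their adjoints. -/
def liftAlg (f : G → B) : FreeStarAlg G →ₐ[ℂ] B :=
  FreeAlgebra.lift ℂ (Sum.elim f fun g => star (f g))

theorem liftAlg_letter (f : G → B) (z : G ⊕ G) :
    liftAlg f (letter z) = Sum.elim f (fun g => star (f g)) z :=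
  FreeAlgebra.lift_ι_apply (R := ℂ) (Sum.elim f fun g => star (f g)) z

/-- The universal property of the free `*`-algebra. -/
def lift [StarModule ℂ B] (f : G → B) : FreeStarAlg G →⋆ₐ[ℂ] B where
  __ := liftAlg f
  map_star' a := by
    change liftAlg f (star a) = star (liftAlg f a)
    induction a using induction with
    | h₀ r =>
      rw [star_algebraMap', AlgHom.commutes, AlgHom.commutes]
      exact algebraMap_star_comm r
    | h₁ z =>
      rw [star_letter, liftAlg_letter, liftAlg_letter]
      cases z <;> simp
    | hm a b h₁ h₂ => rw [star_mul, map_mul, map_mul, star_mul, h₁, h₂]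
    | ha a b h₁ h₂ => rw [star_add, map_add, map_add, star_add, h₁, h₂]

@[simp]
theorem lift_gen [StarModule ℂ B] (f : G → B) (g : G) : lift f (gen g) = f g :=
  liftAlg_letter f (Sum.inl g)

theorem hom_ext {φ ψ : FreeStarAlg G →⋆ₐ[ℂ] B} (h : ∀ g, φ (gen g) = ψ (gen g)) : φ = ψ := by
  ext a
  induction a using induction with
  | h₀ r => rw [AlgHomClass.commutes, AlgHomClass.commutes]
  | h₁ z =>
    rcases z with g | g
    · exact h g
    · have : letter (Sum.inr g) = star (gen g) := (star_letter (Sum.inl g)).symm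
      rw [this, map_star, map_star, h g]
  | hm a b h₁ h₂ => rw [map_mul, map_mul, h₁, h₂]
  | ha a b h₁ h₂ => rw [map_add, map_add, h₁, h₂]

end lift

end FreeStarAlg

/-! ### `C*`-seminorms and completions -/

/-- A `C*`-seminorm on a unital complex `*`-algebra. -/
structure CStarSeminorm (A : Type*) [Ring A] [StarRing A] [Algebra ℂ A] extends
    Seminorm ℂ A where
  mul_le' : ∀ a b, toFun (a * b) ≤ toFun a * toFun b
  star_mul_self' : ∀ a, toFun (star a * a) = toFun a * toFun a

namespace CStarSeminorm

variable {A : Type*} [Ring A] [StarRing A] [Algebra ℂ A]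

instance : CoeFun (CStarSeminorm A) fun _ => A → ℝ := ⟨fun p => p.toFun⟩

theorem nonneg (p : CStarSeminorm A) (a : A) : 0 ≤ p a := apply_nonneg p.toSeminorm a

theorem star_eq (p : CStarSeminorm A) (a : A) : p (star a) = p a := by
  have key : ∀ a, p a ≤ p (star a) := fun a => by
    rcases (p.nonneg a).eq_or_lt with h | h
    · rw [← h]; exact p.nonneg _
    · have := (p.star_mul_self' a).symm.le.trans (p.mul_le' _ _)
      exact le_of_mul_le_mul_right this h
  refine le_antisymm ?_ (key a)
  simpa using key (star a)

/-- The algebra `A`, to be endowed with the topology of the seminorm `p`. -/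
@[nolint unusedArguments]
def Pre (_ : CStarSeminorm A) : Type _ := A

variable (p : CStarSeminorm A)

instance : Ring p.Pre := inferInstanceAs (Ring A)
instance : PseudoMetricSpace p.Pre :=
  p.toSeminorm.toAddGroupSeminorm.toSeminormedAddCommGroup.toPseudoMetricSpace
instance : Norm p.Pre := ⟨p.toFun⟩
instance : StarRing p.Pre := inferInstanceAs (StarRing A)
instance : Algebra ℂ p.Pre := inferInstanceAs (Algebra ℂ A)

instance : SeminormedRing p.Pre where
  dist_eq := p.toSeminorm.toAddGroupSeminorm.toSeminormedAddCommGroup.dist_eq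
  norm_mul_le := p.mul_le'

theorem norm_def (a : p.Pre) : ‖a‖ = p a := rfl

instance : NormedAlgebra ℂ p.Pre where
  __ := (inferInstance : Algebra ℂ p.Pre)
  norm_smul_le c a := (map_smul_eq_mul p.toSeminorm c a).le

theorem norm_star_pre (a : p.Pre) : ‖star a‖ = ‖a‖ := p.star_eq a

theorem star_isometry : Isometry (star : p.Pre → p.Pre) :=
  AddMonoidHomClass.isometry_of_norm (starAddEquiv : p.Pre ≃+ p.Pre) p.norm_star_pre

/-- The completion of `A` in the seminorm `p` (after dividing by the null space of `p`). -/
abbrev Compl : Type _ := Completion p.Pre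

instance : NormedAlgebra ℂ p.Compl where
  norm_smul_le := norm_smul_le

/-- The canonical map from `A` to its completion. -/
def coe (a : A) : p.Compl := ((show p.Pre from a : p.Pre) : Completion p.Pre)

theorem norm_coe (a : A) : ‖p.coe a‖ = p a := Completion.norm_coe (E := p.Pre) a
theorem coe_add (a b : A) : p.coe (a + b) = p.coe a + p.coe b := Completion.coe_add (α := p.Pre) a b
theorem coe_mul (a b : A) : p.coe (a * b) = p.coe a * p.coe b := Completion.coe_mul (α := p.Pre) a b
theorem coe_smul (c : ℂ) (a : A) : p.coe (c • a) = c • p.coe a :=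
  Completion.coe_smul (X := p.Pre) c a
theorem coe_one : p.coe 1 = 1 := rfl

theorem compl_induction {P : p.Compl → Prop} (x : p.Compl) (hc : IsClosed {x | P x})
    (h : ∀ a, P (p.coe a)) : P x := Completion.induction_on (α := p.Pre) x hc h

theorem compl_induction₂ {P : p.Compl → p.Compl → Prop} (x y : p.Compl)
    (hc : IsClosed {x : p.Compl × p.Compl | P x.1 x.2})
    (h : ∀ a b, P (p.coe a) (p.coe b)) : P x y :=
  Completion.induction_on₂ (α := p.Pre) (β := p.Pre) x y hc h

theorem dense_coe : DenseRange p.coe := Completion.denseRange_coe (α := p.Pre)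

instance : Star p.Compl := ⟨(Completion.map star : Completion p.Pre → Completion p.Pre)⟩

theorem coe_star (a : A) : p.coe (star a) = star (p.coe a) :=
  (Completion.map_coe (α := p.Pre) p.star_isometry.uniformContinuous a).symm

theorem continuous_star : Continuous (star : p.Compl → p.Compl) :=
  Completion.continuous_map (α := p.Pre) (f := star)

instance : StarRing p.Compl where
  star_involutive x := by
    induction x using p.compl_induction with
    | hc => exact isClosed_eq (p.continuous_star.comp p.continuous_star) continuous_id
    | h a => rw [← coe_star, ← coe_star, star_star]
  star_mul x y := by
    have := p.continuous_star
    induction x, y using p.compl_induction₂ with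
    | hc => apply isClosed_eq <;> fun_prop
    | h a b => rw [← coe_mul, ← coe_star, ← coe_star, ← coe_star, star_mul, coe_mul]
  star_add x y := by
    have := p.continuous_star
    induction x, y using p.compl_induction₂ with
    | hc => apply isClosed_eq <;> fun_prop
    | h a b => rw [← coe_add, ← coe_star, ← coe_star, ← coe_star, star_add, coe_add]

instance [StarModule ℂ A] : StarModule ℂ p.Compl where
  star_smul c x := by
    induction x using p.compl_induction with
    | hc =>
      exact isClosed_eq (p.continuous_star.comp (continuous_const_smul c))
        (p.continuous_star.const_smul (star c))
    | h a => rw [← coe_smul, ← coe_star, ← coe_star, star_smul, coe_smul]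

instance : CStarRing p.Compl where
  norm_mul_self_le x := by
    induction x using p.compl_induction with
    | hc =>
      exact isClosed_le (continuous_norm.mul continuous_norm)
        (continuous_norm.comp (p.continuous_star.mul continuous_id))
    | h a =>
      rw [← coe_star, ← coe_mul, norm_coe, norm_coe]
      exact (p.star_mul_self' a).symm.le

instance [StarModule ℂ A] : CStarAlgebra p.Compl where

/-- The canonical `*`-homomorphism from `A` to its completion. -/
def coeHom [StarModule ℂ A] : A →⋆ₐ[ℂ] p.Compl where
  toFun := p.coe
  map_one' := p.coe_one
  map_mul' := p.coe_mul
  map_zero' := rfl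
  map_add' := p.coe_add
  commutes' c := by
    rw [Algebra.algebraMap_eq_smul_one, coe_smul, coe_one, Algebra.algebraMap_eq_smul_one]
  map_star' := p.coe_star

section extend

variable [StarModule ℂ A] {B : Type*} [CStarAlgebra B]

/-- A `*`-homomorphism to a `C*`-algebra that is bounded by `p` extends to the completion. -/
def extend (f : A →⋆ₐ[ℂ] B) (hf : ∀ a, ‖f a‖ ≤ p a) : p.Compl →⋆ₐ[ℂ] B :=
  let L : p.Pre →L[ℂ] B := LinearMap.mkContinuous (f.toAlgHom.toLinearMap : A →ₗ[ℂ] B) 1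
    (fun a => by rw [one_mul]; exact hf a)
  let F : p.Compl →L[ℂ] B := (L.fromCompletion : Completion p.Pre →L[ℂ] B)
  have hF : ∀ a : A, F (p.coe a) = f a := fun a => L.fromCompletion_apply_coe (show p.Pre from a)
  { toFun := F
    map_one' := by rw [← coe_one, hF, map_one]
    map_mul' := fun x y => by
      induction x, y using p.compl_induction₂ with
      | hc => apply isClosed_eq <;> fun_prop
      | h a b => rw [← coe_mul, hF, hF, hF, map_mul]
    map_zero' := map_zero F
    map_add' := map_add F
    commutes' := fun c => by
      rw [Algebra.algebraMap_eq_smul_one, map_smul, ← coe_one, hF, map_one,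
        Algebra.algebraMap_eq_smul_one]
    map_star' := fun x => by
      have := p.continuous_star
      induction x using p.compl_induction with
      | hc => apply isClosed_eq <;> fun_prop
      | h a => rw [← coe_star, hF, hF, map_star] }

@[simp]
theorem extend_coe (f : A →⋆ₐ[ℂ] B) (hf : ∀ a, ‖f a‖ ≤ p a) (a : A) :
    p.extend f hf (p.coe a) = f a :=
  ContinuousLinearMap.fromCompletion_apply_coe (α := p.Pre) _ a

end extend

/-- The `C*`-seminorm that a `*`-homomorphism to a `C*`-algebra induces. -/
def ofHom {B : Type*} [CStarAlgebra B] (f : A →⋆ₐ[ℂ] B) : CStarSeminorm A where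
  __ := (normSeminorm ℂ B).comp f.toAlgHom.toLinearMap
  mul_le' a b := by
    change ‖f (a * b)‖ ≤ ‖f a‖ * ‖f b‖
    rw [map_mul]; exact norm_mul_le _ _
  star_mul_self' a := by
    change ‖f (star a * a)‖ = ‖f a‖ * ‖f a‖
    rw [map_mul, map_star]; exact CStarRing.norm_star_mul_self

theorem ofHom_apply {B : Type*} [CStarAlgebra B] (f : A →⋆ₐ[ℂ] B) (a : A) :
    ofHom f a = ‖f a‖ := rfl

end CStarSeminorm

theorem continuous_starAlgHom {A B : Type*} [CStarAlgebra A] [CStarAlgebra B]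
    (f : A →⋆ₐ[ℂ] B) : Continuous f :=
  AddMonoidHomClass.continuous_of_bound f 1 fun x => by
    rw [one_mul]; exact NonUnitalStarAlgHom.norm_apply_le f x

/-! ### Universal unital `C*`-algebras given by generators and relations -/

section Universal

variable {G : Type*}

/-- The `C*`-seminorms on the free `*`-algebra on `G` that vanish on the relators in `R`, that is,
the `C*`-seminorms on the universal unital `*`-algebra with generators `G` and relations `R`. -/
def AdmissibleSeminorm (R : Set (FreeStarAlg G)) : Type _ :=
  {p : CStarSeminorm (FreeStarAlg G) // ∀ r ∈ R, p r = 0}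

instance (R : Set (FreeStarAlg G)) : Nonempty (AdmissibleSeminorm R) :=
  ⟨{ toSeminorm := 0
     mul_le' := fun _ _ => (mul_zero (0 : ℝ)).ge
     star_mul_self' := fun _ => (mul_zero (0 : ℝ)).symm }, fun _ _ => rfl⟩

/-- On each generator, the admissible `C*`-seminorms are uniformly bounded. -/
def IsBoundedPresentation (R : Set (FreeStarAlg G)) : Prop :=
  ∀ g : G, ∃ C : ℝ, ∀ p : AdmissibleSeminorm R, p.1 (FreeStarAlg.gen g) ≤ C

variable {R : Set (FreeStarAlg G)}

theorem AdmissibleSeminorm.bddAbove (hR : IsBoundedPresentation R) (a : FreeStarAlg G) :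
    BddAbove (Set.range fun p : AdmissibleSeminorm R => p.1 a) := by
  suffices h : ∃ C : ℝ, ∀ p : AdmissibleSeminorm R, p.1 a ≤ C by
    obtain ⟨C, hC⟩ := h
    exact ⟨C, by rintro _ ⟨p, rfl⟩; exact hC p⟩
  induction a using FreeStarAlg.induction with
  | h₀ r =>
    refine ⟨‖r‖ * 1, fun p => ?_⟩
    rw [Algebra.algebraMap_eq_smul_one]
    refine (map_smul_eq_mul p.1.toSeminorm r 1).le.trans ?_
    refine mul_le_mul_of_nonneg_left ?_ (norm_nonneg _)
    have h := p.1.star_mul_self' 1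
    rw [star_one, one_mul] at h
    change p.1 1 ≤ 1
    have h0 := p.1.nonneg 1
    nlinarith
  | h₁ z =>
    rcases z with g | g
    · exact hR g
    · obtain ⟨C, hC⟩ := hR g
      refine ⟨C, fun p => ?_⟩
      rw [← p.1.star_eq, FreeStarAlg.star_letter]
      exact hC p
  | hm a b h₁ h₂ =>
    obtain ⟨C₁, h₁⟩ := h₁
    obtain ⟨C₂, h₂⟩ := h₂
    refine ⟨C₁ * C₂, fun p => (p.1.mul_le' a b).trans ?_⟩
    exact mul_le_mul (h₁ p) (h₂ p) (p.1.nonneg b) ((p.1.nonneg a).trans (h₁ p))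
  | ha a b h₁ h₂ =>
    obtain ⟨C₁, h₁⟩ := h₁
    obtain ⟨C₂, h₂⟩ := h₂
    exact ⟨C₁ + C₂, fun p =>
      (map_add_le_add p.1.toSeminorm a b).trans (add_le_add (h₁ p) (h₂ p))⟩

/-- The largest `C*`-seminorm on the universal unital `*`-algebra with generators `G` and
relations `R`. -/
def maxSeminorm (hR : IsBoundedPresentation R) : CStarSeminorm (FreeStarAlg G) where
  toFun a := ⨆ p : AdmissibleSeminorm R, p.1 a
  map_zero' := by
    have : ∀ p : AdmissibleSeminorm R, p.1 0 = 0 := fun p => map_zero p.1.toSeminorm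
    simp [this]
  add_le' a b := ciSup_le fun p => (map_add_le_add p.1.toSeminorm a b).trans <|
    add_le_add (le_ciSup (AdmissibleSeminorm.bddAbove hR a) p)
      (le_ciSup (AdmissibleSeminorm.bddAbove hR b) p)
  neg' a := by
    have : ∀ p : AdmissibleSeminorm R, p.1 (-a) = p.1 a := fun p => map_neg_eq_map p.1.toSeminorm a
    simp [this]
  smul' c a := by
    rw [Real.mul_iSup_of_nonneg (norm_nonneg c)]
    exact iSup_congr fun p => map_smul_eq_mul p.1.toSeminorm c a
  mul_le' a b := ciSup_le fun p => (p.1.mul_le' a b).trans <|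
    mul_le_mul (le_ciSup (AdmissibleSeminorm.bddAbove hR a) p)
      (le_ciSup (AdmissibleSeminorm.bddAbove hR b) p) (p.1.nonneg b)
      (Real.iSup_nonneg fun p => p.1.nonneg a)
  star_mul_self' a := by
    refine le_antisymm (ciSup_le fun p => ?_) ?_
    · rw [p.1.star_mul_self']
      exact mul_self_le_mul_self (p.1.nonneg a) (le_ciSup (AdmissibleSeminorm.bddAbove hR a) p)
    · have h0 : (0 : ℝ) ≤ ⨆ p : AdmissibleSeminorm R, p.1 (star a * a) :=
        Real.iSup_nonneg fun p => p.1.nonneg _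
      suffices h : (⨆ p : AdmissibleSeminorm R, p.1 a) ≤
          √(⨆ p : AdmissibleSeminorm R, p.1 (star a * a)) by
        calc (⨆ p : AdmissibleSeminorm R, p.1 a) * (⨆ p : AdmissibleSeminorm R, p.1 a)
            ≤ √(⨆ p : AdmissibleSeminorm R, p.1 (star a * a)) *
              √(⨆ p : AdmissibleSeminorm R, p.1 (star a * a)) :=
              mul_self_le_mul_self (Real.iSup_nonneg fun p => p.1.nonneg a) h
          _ = _ := Real.mul_self_sqrt h0
      refine ciSup_le fun p => ?_
      refine Real.le_sqrt_of_sq_le ?_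
      rw [sq, ← p.1.star_mul_self']
      exact le_ciSup (AdmissibleSeminorm.bddAbove hR (star a * a)) p

/-- The universal unital `C*`-algebra with generators `G` and relations `r = 0` for `r ∈ R`. -/
def UnivCStar (hR : IsBoundedPresentation R) : Type _ := (maxSeminorm hR).Compl

namespace UnivCStar

variable (hR : IsBoundedPresentation R)

instance : CStarAlgebra (UnivCStar hR) := inferInstanceAs (CStarAlgebra (maxSeminorm hR).Compl)

/-- The canonical map from the free `*`-algebra to the universal `C*`-algebra. -/
def mk : FreeStarAlg G →⋆ₐ[ℂ] UnivCStar hR := (maxSeminorm hR).coeHom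

/-- The generators of the universal `C*`-algebra. -/
def gen (g : G) : UnivCStar hR := mk hR (FreeStarAlg.gen g)

theorem dense_mk : DenseRange (mk hR) := (maxSeminorm hR).dense_coe

theorem mk_eq_zero {r : FreeStarAlg G} (hr : r ∈ R) : mk hR r = 0 := by
  refine norm_eq_zero.mp (((maxSeminorm hR).norm_coe r).trans ?_)
  exact (iSup_congr fun p : AdmissibleSeminorm R => p.2 r hr).trans ciSup_const

variable {B : Type*} [CStarAlgebra B]

/-- The universal property. -/
def lift (f : G → B) (hf : ∀ r ∈ R, FreeStarAlg.lift f r = 0) : UnivCStar hR →⋆ₐ[ℂ] B :=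
  (maxSeminorm hR).extend (FreeStarAlg.lift f) fun a =>
    le_ciSup (AdmissibleSeminorm.bddAbove hR a)
      ⟨CStarSeminorm.ofHom (FreeStarAlg.lift f), fun r hr => norm_eq_zero.mpr (hf r hr)⟩

@[simp]
theorem lift_gen (f : G → B) (hf : ∀ r ∈ R, FreeStarAlg.lift f r = 0) (g : G) :
    lift hR f hf (gen hR g) = f g :=
  ((maxSeminorm hR).extend_coe (FreeStarAlg.lift f) _ (FreeStarAlg.gen g)).trans
    (FreeStarAlg.lift_gen f g)

theorem hom_ext {φ ψ : UnivCStar hR →⋆ₐ[ℂ] B} (h : ∀ g, φ (gen hR g) = ψ (gen hR g)) :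
    φ = ψ := by
  have h₁ : φ.comp (mk hR) = ψ.comp (mk hR) := FreeStarAlg.hom_ext h
  refine DFunLike.coe_injective
    ((dense_mk hR).equalizer (continuous_starAlgHom φ) (continuous_starAlgHom ψ) ?_)
  exact congrArg DFunLike.coe h₁

end UnivCStar

theorem isBoundedPresentation_of_norm_le {G : Type*} {R : Set (FreeStarAlg G)}
    (h : ∀ p : CStarSeminorm (FreeStarAlg G), (∀ r ∈ R, p.coeHom r = 0) →
      ∀ g, ‖p.coeHom (FreeStarAlg.gen g)‖ ≤ 1) : IsBoundedPresentation R := fun g =>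
  ⟨1, fun p => by
    rw [← p.1.norm_coe]
    exact h p.1 (fun r hr => norm_eq_zero.mp ((p.1.norm_coe r).trans (p.2 r hr))) g⟩

end Universal

section Unitary

theorem norm_le_one_of_sum_star_mul_self {ι B : Type*} [Fintype ι] [CStarAlgebra B]
    (a : ι → B) (h : ∑ k, star (a k) * a k = 1) (k : ι) : ‖a k‖ ≤ 1 := by
  let := CStarAlgebra.spectralOrder B
  have := CStarAlgebra.spectralOrderedRing B
  rcases subsingleton_or_nontrivial B with hB | hB
  · rw [Subsingleton.elim (a k) 0, norm_zero]; exact zero_le_one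
  have h₁ : star (a k) * a k ≤ 1 := by
    rw [← h]
    exact Finset.single_le_sum (f := fun k => star (a k) * a k)
      (fun i _ => star_mul_self_nonneg (a i)) (Finset.mem_univ k)
  have h₂ : ‖star (a k) * a k‖ ≤ 1 :=
    (CStarAlgebra.norm_le_one_iff_of_nonneg _ (star_mul_self_nonneg _)).mpr h₁
  rw [CStarRing.norm_star_mul_self] at h₂
  nlinarith [norm_nonneg (a k)]

end Unitary

/-! ### `ℤ/N`-`C*`-algebras -/

section Coaction

/-- The function `t ↦ ω ^ t` on `ℤ/N`, for an `N`-th root of unity `ω`. -/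
def chi {N : ℕ} (ω : ℂ) (t : ZMod N) : ℂ := ω ^ t.val

/-- A coaction of `C(ℤ/N)` on a unital `C*`-algebra `X`, that is, a unital `*`-homomorphism
`ρ : X → X ⊗ C(ℤ/N) = C(ℤ/N, X)` which satisfies `(ρ ⊗ id) ρ = (id ⊗ Δ) ρ` and for which the
closed linear span of `ρ(X) (1 ⊗ C(ℤ/N))` is `X ⊗ C(ℤ/N)`.  A `ℤ/N`-`C*`-algebra is a unital
`C*`-algebra with such a coaction. -/
structure Coaction (N : ℕ) [NeZero N] (X : Type*) [CStarAlgebra X] where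
  hom : X →⋆ₐ[ℂ] (ZMod N → X)
  coassoc : ∀ x s t, hom (hom x t) s = hom x (s + t)
  podles : Dense (Submodule.span ℂ
    {h : ZMod N → X | ∃ (x : X) (f : ZMod N → ℂ), h = fun t => f t • hom x t} :
      Set (ZMod N → X))

/-- A `*`-homomorphism `ρ : X → C(ℤ/N, X)` that comes from an action of `ℤ/N` by automorphisms is a
coaction. -/
def Coaction.ofAction {N : ℕ} [NeZero N] {X : Type*} [CStarAlgebra X]
    (ρ : X →⋆ₐ[ℂ] (ZMod N → X)) (h₀ : ∀ x, ρ x 0 = x)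
    (h₁ : ∀ x s t, ρ (ρ x t) s = ρ x (s + t)) : Coaction N X where
  hom := ρ
  coassoc := h₁
  podles := by
    intro f
    refine subset_closure ?_
    have hf : f = ∑ s : ZMod N, fun t => (if t = s then (1 : ℂ) else 0) • ρ (ρ (f s) (-s)) t := by
      funext t
      simp [Finset.sum_apply, h₁, h₀, ite_smul]
    rw [hf]
    exact Submodule.sum_mem _ fun s _ =>
      Submodule.subset_span ⟨ρ (f s) (-s), fun t => if t = s then 1 else 0, rfl⟩

variable {N : ℕ} [NeZero N] {X Y : Type*} [CStarAlgebra X] [CStarAlgebra Y]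

/-- The `ℤ/N`-equivariant morphisms between two `ℤ/N`-`C*`-algebras: the unital
`*`-homomorphisms `φ` with `ρ^Y φ = (φ ⊗ id) ρ^X`. -/
structure EquivariantHom (ρX : Coaction N X) (ρY : Coaction N Y) extends X →⋆ₐ[ℂ] Y where
  equivariant : ∀ x t, ρY.hom (toStarAlgHom x) t = toStarAlgHom (ρX.hom x t)

instance {ρX : Coaction N X} {ρY : Coaction N Y} :
    CoeFun (EquivariantHom ρX ρY) fun _ => X → Y := ⟨fun φ => φ.toStarAlgHom⟩

/-- A homogeneous element of degree `d`: `ρ_t(x) = ω ^ (t d) x`. -/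
def IsHomogeneous (ω : ℂ) (ρ : Coaction N X) (d : ZMod N) (x : X) : Prop :=
  ∀ t, ρ.hom x t = chi ω (t * d) • x

end Coaction

section Chi

set_option linter.unusedSectionVars false

variable {N : ℕ} [NeZero N] {ω : ℂ}

theorem chi_natCast (hω : IsPrimitiveRoot ω N) (n : ℕ) : chi ω (n : ZMod N) = ω ^ n := by
  rw [chi, ZMod.val_natCast, ← pow_mod_orderOf ω n, ← hω.eq_orderOf]

theorem chi_add (hω : IsPrimitiveRoot ω N) (s t : ZMod N) : chi ω (s + t) = chi ω s * chi ω t := by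
  rw [← ZMod.natCast_zmod_val s, ← ZMod.natCast_zmod_val t, ← Nat.cast_add, chi_natCast hω,
    chi_natCast hω, chi_natCast hω, pow_add]

theorem chi_zero : chi ω (0 : ZMod N) = 1 := by simp [chi]

theorem chi_neg_mul_self (hω : IsPrimitiveRoot ω N) (s : ZMod N) : chi ω (-s) * chi ω s = 1 := by
  rw [← chi_add hω, neg_add_cancel, chi_zero]

theorem chi_conj (hω : IsPrimitiveRoot ω N) (s : ZMod N) : conj (chi ω s) = chi ω (-s) := by
  have h₁ : ‖chi ω s‖ = 1 := by
    rw [chi, norm_pow, hω.norm'_eq_one (NeZero.ne N), one_pow]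
  have h₂ : conj (chi ω s) * chi ω s = 1 := by
    rw [Complex.conj_mul', h₁]; simp
  have h₃ : chi ω s ≠ 0 := fun h => by simp [h] at h₁
  exact mul_right_cancel₀ h₃ (h₂.trans (chi_neg_mul_self hω s).symm)

theorem chi_star (hω : IsPrimitiveRoot ω N)
    (s : ZMod N) : star (chi ω s) = chi ω (-s) := chi_conj hω s

theorem sum_chi_mul (hω : IsPrimitiveRoot ω N) (a : ZMod N) :
    ∑ t : ZMod N, chi ω (t * a) = if a = 0 then (N : ℂ) else 0 := by
  split_ifs with ha
  · simp [ha, chi_zero, ZMod.card]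
  · have h : chi ω a * ∑ t : ZMod N, chi ω (t * a) = ∑ t : ZMod N, chi ω (t * a) := by
      rw [Finset.mul_sum, ← Equiv.sum_comp (Equiv.addRight (1 : ZMod N)) fun t => chi ω (t * a)]
      refine Finset.sum_congr rfl fun t _ => ?_
      rw [Equiv.coe_addRight, add_mul, one_mul, chi_add hω, mul_comm]
    have h1 : chi ω a ≠ 1 := by
      intro h1
      have := hω.dvd_of_pow_eq_one a.val h1
      have hlt := ZMod.val_lt a
      have h0 : a.val = 0 := Nat.eq_zero_of_dvd_of_lt this hlt
      exact ha ((ZMod.val_eq_zero a).mp h0)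
    by_contra h2
    exact h1 (mul_right_cancel₀ h2 (h.trans (one_mul _).symm))

end Chi

/-! ### Hilbert space tensor products -/

section Tensor

universe u v

/-- The Hilbert space tensor product. -/
abbrev HTensor (H : Type*) (K : Type*) [NormedAddCommGroup H] [InnerProductSpace ℂ H]
    [NormedAddCommGroup K] [InnerProductSpace ℂ K] : Type _ := Completion (H ⊗[ℂ] K)

variable {H K L : Type*} [NormedAddCommGroup H] [InnerProductSpace ℂ H]
  [NormedAddCommGroup K] [InnerProductSpace ℂ K] [NormedAddCommGroup L] [InnerProductSpace ℂ L]

instance [Nontrivial H] [Nontrivial K] : Nontrivial (HTensor H K) := by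
  obtain ⟨x, hx⟩ := exists_ne (0 : H)
  obtain ⟨y, hy⟩ := exists_ne (0 : K)
  refine ⟨⟨((x ⊗ₜ[ℂ] y : H ⊗[ℂ] K) : HTensor H K), 0, fun h => ?_⟩⟩
  have := congrArg norm h
  rw [Completion.norm_coe, TensorProduct.norm_tmul, norm_zero] at this
  exact mul_ne_zero (norm_ne_zero_iff.mpr hx) (norm_ne_zero_iff.mpr hy) this

theorem HTensor.ext {F : Type*} [NormedAddCommGroup F] [NormedSpace ℂ F]
    {S T : HTensor H K →L[ℂ] F}
    (h : ∀ (x : H) (y : K), S (x ⊗ₜ[ℂ] y : H ⊗[ℂ] K) = T (x ⊗ₜ[ℂ] y : H ⊗[ℂ] K)) : S = T := by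
  ext z
  induction z using Completion.induction_on with
  | hp => exact isClosed_eq S.continuous T.continuous
  | ih z =>
    induction z using TensorProduct.induction_on with
    | zero => rw [Completion.coe_zero, map_zero, map_zero]
    | tmul x y => exact h x y
    | add a b ha hb => rw [Completion.coe_add, map_add, map_add, ha, hb]

variable (K) in
/-- The map `T ↦ T ⊗ 1` from operators on `H` to operators on `H ⊗ K`. -/
def ampl [CompleteSpace H] : (H →L[ℂ] H) →⋆ₐ[ℂ] (HTensor H K →L[ℂ] HTensor H K) where
  toFun T := (T.rTensor K).completion
  map_one' := HTensor.ext fun x y => by simp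
  map_mul' S T := HTensor.ext fun x y => by simp
  map_zero' := HTensor.ext fun x y => by simp
  map_add' S T := HTensor.ext fun x y => by
    simp [Completion.coe_add]
  commutes' c := HTensor.ext fun x y => by
    rw [Algebra.algebraMap_eq_smul_one, Algebra.algebraMap_eq_smul_one]
    simp
  map_star' T := by
    rw [ContinuousLinearMap.star_eq_adjoint, ContinuousLinearMap.star_eq_adjoint,
      ContinuousLinearMap.eq_adjoint_iff]
    intro a b
    induction a, b using Completion.induction_on₂ with
    | hp => exact isClosed_eq (by fun_prop) (by fun_prop)
    | ih a b =>
      rw [ContinuousLinearMap.completion_apply_coe, ContinuousLinearMap.completion_apply_coe,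
        Completion.inner_coe, Completion.inner_coe]
      induction a using TensorProduct.induction_on with
      | zero => simp
      | add a a' h h' => rw [map_add, inner_add_left, inner_add_left, h, h']
      | tmul x y =>
        induction b using TensorProduct.induction_on with
        | zero => simp
        | add a a' h h' => rw [map_add, inner_add_right, inner_add_right, h, h']
        | tmul x' y' => simp [ContinuousLinearMap.adjoint_inner_left]

@[simp]
theorem ampl_tmul [CompleteSpace H] (T : H →L[ℂ] H) (x : H) (y : K) :
    ampl K T ((x ⊗ₜ[ℂ] y : H ⊗[ℂ] K) : HTensor H K) = (T x ⊗ₜ[ℂ] y : H ⊗[ℂ] K) :=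
  (T.rTensor K).completion_apply_coe (x ⊗ₜ[ℂ] y)

/-- The extension of a linear isometric isomorphism to the completions. -/
def complIso {E F : Type*} [NormedAddCommGroup E] [InnerProductSpace ℂ E]
    [NormedAddCommGroup F] [InnerProductSpace ℂ F] (e : E ≃ₗᵢ[ℂ] F) :
    Completion E ≃ₗᵢ[ℂ] Completion F where
  toFun := (e.toContinuousLinearEquiv : E →L[ℂ] F).completion
  map_add' := map_add _
  map_smul' := map_smul _
  invFun := (e.symm.toContinuousLinearEquiv : F →L[ℂ] E).completion
  left_inv x := by
    induction x using Completion.induction_on with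
    | hp => exact isClosed_eq (by fun_prop) (by fun_prop)
    | ih a => simp
  right_inv x := by
    induction x using Completion.induction_on with
    | hp => exact isClosed_eq (by fun_prop) (by fun_prop)
    | ih a => simp
  norm_map' x := by
    change ‖(e.toContinuousLinearEquiv : E →L[ℂ] F).completion x‖ = ‖x‖
    induction x using Completion.induction_on with
    | hp => exact isClosed_eq (by fun_prop) (by fun_prop)
    | ih a => simp

theorem complIso_coe {E F : Type*} [NormedAddCommGroup E] [InnerProductSpace ℂ E]
    [NormedAddCommGroup F] [InnerProductSpace ℂ F] (e : E ≃ₗᵢ[ℂ] F) (x : E) :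
    complIso e (x : Completion E) = (e x : F) :=
  (e.toContinuousLinearEquiv : E →L[ℂ] F).completion_apply_coe x

end Tensor

/-! ### The braiding -/

section Braiding

set_option linter.unusedSectionVars false

variable {N : ℕ} [NeZero N] {ω : ℂ} {H K : Type*} [NormedAddCommGroup H] [InnerProductSpace ℂ H]
  [NormedAddCommGroup K] [InnerProductSpace ℂ K]

/-- The projection of a unitary representation `U` of `ℤ/N` onto its subspace of degree `m`, on
which `U t` is the multiplication by `ω ^ (t m)`. -/
def degreeProj (ω : ℂ) (U : Multiplicative (ZMod N) →* (H ≃ₗᵢ[ℂ] H)) (m : ZMod N) : H →ₗ[ℂ] H :=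
  (N : ℂ)⁻¹ • ∑ t : ZMod N, chi ω (-(t * m)) • (U (.ofAdd t)).toLinearEquiv.toLinearMap

theorem degreeProj_apply (U : Multiplicative (ZMod N) →* (H ≃ₗᵢ[ℂ] H)) (m : ZMod N) (x : H) :
    degreeProj ω U m x = (N : ℂ)⁻¹ • ∑ t : ZMod N, chi ω (-(t * m)) • U (.ofAdd t) x := by
  simp [degreeProj, LinearMap.sum_apply]

theorem unitary_add (U : Multiplicative (ZMod N) →* (H ≃ₗᵢ[ℂ] H)) (s t : ZMod N) (x : H) :
    U (.ofAdd (s + t)) x = U (.ofAdd s) (U (.ofAdd t) x) := by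
  rw [ofAdd_add, map_mul]; rfl

theorem unitary_zero (U : Multiplicative (ZMod N) →* (H ≃ₗᵢ[ℂ] H)) (x : H) :
    U (.ofAdd 0) x = x := by
  rw [ofAdd_zero, map_one]; rfl

theorem unitary_inner (U : Multiplicative (ZMod N) →* (H ≃ₗᵢ[ℂ] H)) (t : ZMod N) (x y : H) :
    inner ℂ (U (.ofAdd t) x) y = inner ℂ x (U (.ofAdd (-t)) y) := by
  rw [← (U (.ofAdd t)).inner_map_map x, ← unitary_add, add_neg_cancel, unitary_zero]

section


theorem degreeProj_unitary (hω : IsPrimitiveRoot ω N)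
    (U : Multiplicative (ZMod N) →* (H ≃ₗᵢ[ℂ] H)) (m s : ZMod N) (x : H) :
    degreeProj ω U m (U (.ofAdd s) x) = chi ω (s * m) • degreeProj ω U m x := by
  rw [degreeProj_apply, degreeProj_apply, smul_comm (chi ω (s * m))]
  congr 1
  rw [Finset.smul_sum, ← Equiv.sum_comp (Equiv.addRight s) fun t =>
      chi ω (s * m) • chi ω (-(t * m)) • U (.ofAdd t) x]
  refine Finset.sum_congr rfl fun t _ => ?_
  rw [Equiv.coe_addRight, unitary_add, smul_smul, ← chi_add hω]
  congr 2
  ring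

theorem unitary_degreeProj (hω : IsPrimitiveRoot ω N)
    (U : Multiplicative (ZMod N) →* (H ≃ₗᵢ[ℂ] H)) (m s : ZMod N) (x : H) :
    U (.ofAdd s) (degreeProj ω U m x) = chi ω (s * m) • degreeProj ω U m x := by
  rw [← degreeProj_unitary hω, degreeProj_apply, degreeProj_apply, map_smul, map_sum]
  congr 1
  refine Finset.sum_congr rfl fun t _ => ?_
  rw [map_smul, ← unitary_add, ← unitary_add, add_comm]

theorem degreeProj_degreeProj (hω : IsPrimitiveRoot ω N)
    (U : Multiplicative (ZMod N) →* (H ≃ₗᵢ[ℂ] H)) (m n : ZMod N)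
    (x : H) :
    degreeProj ω U n (degreeProj ω U m x) = if m = n then degreeProj ω U m x else 0 := by
  rw [degreeProj_apply (m := n)]
  simp only [unitary_degreeProj hω, smul_smul, ← chi_add hω]
  have h : ∀ t : ZMod N, -(t * n) + t * m = t * (m - n) := fun t => by ring
  simp only [h]
  rw [← Finset.sum_smul, sum_chi_mul hω]
  simp only [sub_eq_zero]
  split_ifs
  · rw [smul_smul, inv_mul_cancel₀ (Nat.cast_ne_zero.mpr (NeZero.ne N)), one_smul]
  · simp

theorem sum_degreeProj (hω : IsPrimitiveRoot ω N)
    (U : Multiplicative (ZMod N) →* (H ≃ₗᵢ[ℂ] H)) (x : H) :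
    ∑ m : ZMod N, degreeProj ω U m x = x := by
  simp only [degreeProj_apply]
  rw [← Finset.smul_sum, Finset.sum_comm]
  simp only [← Finset.sum_smul]
  have h : ∀ t m : ZMod N, -(t * m) = m * (-t) := fun t m => by ring
  simp only [h, sum_chi_mul hω, neg_eq_zero, ite_smul, zero_smul]
  rw [Finset.sum_ite_eq' Finset.univ (0 : ZMod N), if_pos (Finset.mem_univ _), unitary_zero,
    smul_smul, inv_mul_cancel₀ (Nat.cast_ne_zero.mpr (NeZero.ne N)), one_smul]

theorem degreeProj_of_degree (hω : IsPrimitiveRoot ω N)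
    (U : Multiplicative (ZMod N) →* (H ≃ₗᵢ[ℂ] H)) (m n : ZMod N) (x : H)
    (hx : ∀ t, U (.ofAdd t) x = chi ω (t * m) • x) :
    degreeProj ω U n x = if m = n then x else 0 := by
  have h : degreeProj ω U m x = x := by
    rw [degreeProj_apply]
    simp only [hx, smul_smul, chi_neg_mul_self hω, one_smul, Finset.sum_const, Finset.card_univ,
      ZMod.card, ← Nat.cast_smul_eq_nsmul ℂ]
    rw [inv_mul_cancel₀ (Nat.cast_ne_zero.mpr (NeZero.ne N)), one_smul]
  rw [← h, degreeProj_degreeProj hω]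

theorem degreeProj_inner (hω : IsPrimitiveRoot ω N)
    (U : Multiplicative (ZMod N) →* (H ≃ₗᵢ[ℂ] H)) (m : ZMod N) (x y : H) :
    inner ℂ (degreeProj ω U m x) y = inner ℂ x (degreeProj ω U m y) := by
  simp only [degreeProj_apply, inner_smul_left, inner_smul_right, sum_inner, inner_sum,
    unitary_inner, chi_conj hω]
  congr 1
  · simp
  · rw [← Equiv.sum_comp (Equiv.neg (ZMod N))]
    refine Finset.sum_congr rfl fun t _ => ?_
    simp

end

/-- The map `ξ ⊗ η ↦ ∑ₘ Pₘ ξ ⊗ V (e m) η`, with `Pₘ` the projection onto the degree `m`. -/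
def twistMap (ω : ℂ) (U : Multiplicative (ZMod N) →* (H ≃ₗᵢ[ℂ] H))
    (V : Multiplicative (ZMod N) →* (K ≃ₗᵢ[ℂ] K)) (e : ZMod N) : H ⊗[ℂ] K →ₗ[ℂ] H ⊗[ℂ] K :=
  ∑ m : ZMod N, TensorProduct.map (degreeProj ω U m) (V (.ofAdd (e * m))).toLinearEquiv.toLinearMap

theorem twistMap_tmul (U : Multiplicative (ZMod N) →* (H ≃ₗᵢ[ℂ] H))
    (V : Multiplicative (ZMod N) →* (K ≃ₗᵢ[ℂ] K)) (e : ZMod N) (x : H) (y : K) :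
    twistMap ω U V e (x ⊗ₜ y) = ∑ m : ZMod N, degreeProj ω U m x ⊗ₜ V (.ofAdd (e * m)) y := by
  simp [twistMap, LinearMap.sum_apply]

theorem twistMap_twistMap (hω : IsPrimitiveRoot ω N) (U : Multiplicative (ZMod N) →* (H ≃ₗᵢ[ℂ] H))
    (V : Multiplicative (ZMod N) →* (K ≃ₗᵢ[ℂ] K)) (e : ZMod N) (z : H ⊗[ℂ] K) :
    twistMap ω U V e (twistMap ω U V (-e) z) = z := by
  induction z using TensorProduct.induction_on with
  | zero => simp
  | add a b ha hb => rw [map_add, map_add, ha, hb]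
  | tmul x y =>
    rw [twistMap_tmul, map_sum]
    simp only [twistMap_tmul, degreeProj_degreeProj hω, TensorProduct.ite_tmul, ← unitary_add]
    simp only [Finset.sum_ite_eq, Finset.mem_univ, if_true, ← add_mul, add_neg_cancel, zero_mul,
      unitary_zero]
    rw [← TensorProduct.sum_tmul, sum_degreeProj hω]

theorem twistMap_inner (hω : IsPrimitiveRoot ω N) (U : Multiplicative (ZMod N) →* (H ≃ₗᵢ[ℂ] H))
    (V : Multiplicative (ZMod N) →* (K ≃ₗᵢ[ℂ] K)) (e : ZMod N) (a b : H ⊗[ℂ] K) :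
    inner ℂ (twistMap ω U V e a) b = inner ℂ a (twistMap ω U V (-e) b) := by
  induction a using TensorProduct.induction_on with
  | zero => simp
  | add a a' h h' => rw [map_add, inner_add_left, inner_add_left, h, h']
  | tmul x y =>
    induction b using TensorProduct.induction_on with
    | zero => simp
    | add a a' h h' => rw [map_add, inner_add_right, inner_add_right, h, h']
    | tmul x' y' =>
      simp only [twistMap_tmul, sum_inner, inner_sum, TensorProduct.inner_tmul,
        degreeProj_inner hω, unitary_inner, neg_mul]

/-- The unitary `ξ ⊗ η ↦ ∑ₘ Pₘ ξ ⊗ V m η`, which multiplies `ξ ⊗ η` with `ω ^ (m n)` if `ξ` has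
degree `m` and `η` has degree `n`. -/
def twist (hω : IsPrimitiveRoot ω N) (U : Multiplicative (ZMod N) →* (H ≃ₗᵢ[ℂ] H))
    (V : Multiplicative (ZMod N) →* (K ≃ₗᵢ[ℂ] K)) : H ⊗[ℂ] K ≃ₗᵢ[ℂ] H ⊗[ℂ] K where
  __ := twistMap ω U V 1
  invFun := twistMap ω U V (-1)
  left_inv z := by
    have := twistMap_twistMap hω U V (-1) z
    rwa [neg_neg] at this
  right_inv z := twistMap_twistMap hω U V 1 z
  norm_map' z := by
    change ‖twistMap ω U V 1 z‖ = ‖z‖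
    have h := twistMap_inner hω U V 1 z (twistMap ω U V 1 z)
    have h' := twistMap_twistMap hω U V (-1) z
    rw [neg_neg] at h'
    rw [h'] at h
    rw [@norm_eq_sqrt_re_inner ℂ, @norm_eq_sqrt_re_inner ℂ _ _ _ _ z, h]

theorem twist_tmul (hω : IsPrimitiveRoot ω N) (U : Multiplicative (ZMod N) →* (H ≃ₗᵢ[ℂ] H))
    (V : Multiplicative (ZMod N) →* (K ≃ₗᵢ[ℂ] K)) (x : H) (y : K) :
    twist hω U V (x ⊗ₜ y) = ∑ m : ZMod N, degreeProj ω U m x ⊗ₜ V (.ofAdd m) y := by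
  refine (twistMap_tmul U V 1 x y).trans ?_
  simp only [one_mul]

/-- The braiding unitary `H ⊗ K → K ⊗ H`. -/
def braiding (hω : IsPrimitiveRoot ω N) (U : Multiplicative (ZMod N) →* (H ≃ₗᵢ[ℂ] H))
    (V : Multiplicative (ZMod N) →* (K ≃ₗᵢ[ℂ] K)) : HTensor H K ≃ₗᵢ[ℂ] HTensor K H :=
  complIso ((twist hω U V).trans (TensorProduct.commIsometry ℂ H K))

theorem braiding_tmul (hω : IsPrimitiveRoot ω N) (U : Multiplicative (ZMod N) →* (H ≃ₗᵢ[ℂ] H))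
    (V : Multiplicative (ZMod N) →* (K ≃ₗᵢ[ℂ] K)) (x : H) (y : K) :
    braiding hω U V (x ⊗ₜ[ℂ] y : H ⊗[ℂ] K) =
      (∑ m : ZMod N, V (.ofAdd m) y ⊗ₜ[ℂ] degreeProj ω U m x : K ⊗[ℂ] H) := by
  rw [braiding, complIso_coe, LinearIsometryEquiv.trans_apply, twist_tmul, map_sum]
  simp

/-- The defining formula of the braiding, on vectors that are homogeneous of degrees `m` and `n`:
`ξ ⊗ η ↦ ω ^ (m n) η ⊗ ξ`. -/
theorem braiding_homogeneous (hω : IsPrimitiveRoot ω N)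
    (U : Multiplicative (ZMod N) →* (H ≃ₗᵢ[ℂ] H)) (V : Multiplicative (ZMod N) →* (K ≃ₗᵢ[ℂ] K))
    (m n : ZMod N) (x : H) (y : K) (hx : ∀ t, U (.ofAdd t) x = chi ω (t * m) • x)
    (hy : ∀ t, V (.ofAdd t) y = chi ω (t * n) • y) :
    braiding hω U V (x ⊗ₜ[ℂ] y : H ⊗[ℂ] K) =
      chi ω (m * n) • ((y ⊗ₜ[ℂ] x : K ⊗[ℂ] H) : HTensor K H) := by
  rw [braiding_tmul]
  simp only [degreeProj_of_degree hω U m _ x hx, hy, TensorProduct.tmul_ite]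
  rw [Finset.sum_ite_eq, if_pos (Finset.mem_univ _), ← TensorProduct.smul_tmul',
    Completion.coe_smul]

end Braiding

/-! ### Braided tensor products -/

section BraidedTensor

universe u v u' v'

/-- A covariant representation of a `ℤ/N`-`C*`-algebra on a Hilbert space: a unitary
representation `U` of `ℤ/N` and an equivariant unital representation of `X`. -/
structure CovRep {N : ℕ} [NeZero N] {X : Type u} [CStarAlgebra X] (ρ : Coaction N X) :
    Type (u + 1) where
  H : Type u
  [instNorm : NormedAddCommGroup H]
  [instInner : InnerProductSpace ℂ H]
  [instComplete : CompleteSpace H]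
  [instNontrivial : Nontrivial H]
  U : Multiplicative (ZMod N) →* (H ≃ₗᵢ[ℂ] H)
  rep : X →⋆ₐ[ℂ] (H →L[ℂ] H)
  covariant : ∀ (t : ZMod N) (x : X) (ξ : H),
    U (.ofAdd t) (rep x ξ) = rep (ρ.hom x t) (U (.ofAdd t) ξ)

attribute [instance] CovRep.instNorm CovRep.instInner CovRep.instComplete CovRep.instNontrivial

/-- The pull-back of a covariant representation along an equivariant morphism. -/
abbrev CovRep.comap {N : ℕ} [NeZero N] {X Y : Type u} [CStarAlgebra X] [CStarAlgebra Y]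
    {ρX : Coaction N X} {ρY : Coaction N Y} (φ : EquivariantHom ρX ρY) (i : CovRep ρY) :
    CovRep ρX where
  H := i.H
  U := i.U
  rep := i.rep.comp φ.toStarAlgHom
  covariant t x ξ := by
    have h := i.covariant t (φ.toStarAlgHom x) ξ
    rw [φ.equivariant] at h
    exact h

/-- The `C*`-algebra of bounded families in a product of `C*`-algebras. -/
def CStarProd {I : Type*} (B : I → Type*) [∀ i, CStarAlgebra (B i)] [∀ i, NormOneClass (B i)] :
    Type _ := lp B ⊤

namespace CStarProd

variable {I : Type*} {B : I → Type*} [∀ i, CStarAlgebra (B i)] [∀ i, NormOneClass (B i)]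

/-- The `C*`-algebra structure on the algebra of bounded families. -/
abbrev cstarLp : CStarAlgebra (lp B ⊤) where

instance : CStarAlgebra (CStarProd B) := cstarLp

/-- A family of `*`-homomorphisms defines a `*`-homomorphism into the product. -/
def pi {A : Type*} [CStarAlgebra A] (f : ∀ i, A →⋆ₐ[ℂ] B i) : A →⋆ₐ[ℂ] CStarProd B where
  toFun a := (⟨fun i => f i a, memℓp_infty ⟨‖a‖, by
    rintro _ ⟨i, rfl⟩
    exact NonUnitalStarAlgHom.norm_apply_le (f i) a⟩⟩ : lp B ⊤)
  map_one' := lp.ext (funext fun i => map_one (f i))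
  map_mul' a b := lp.ext (funext fun i => map_mul (f i) a b)
  map_zero' := lp.ext (funext fun i => map_zero (f i))
  map_add' a b := lp.ext (funext fun i => map_add (f i) a b)
  commutes' c := lp.ext (funext fun i => AlgHomClass.commutes (f i) c)
  map_star' a := lp.ext (funext fun i => map_star (f i) a)

/-- The projection onto a factor of the product. -/
def eval (i : I) : CStarProd B →⋆ₐ[ℂ] B i where
  toFun a := (show lp B ⊤ from a) i
  map_one' := rfl
  map_mul' _ _ := rfl
  map_zero' := rfl
  map_add' _ _ := rfl
  commutes' _ := rfl
  map_star' _ := rfl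

theorem ext {a b : CStarProd B} (h : ∀ i, eval i a = eval i b) : a = b :=
  lp.ext (E := B) (funext h)

@[simp]
theorem eval_pi {A : Type*} [CStarAlgebra A] (f : ∀ i, A →⋆ₐ[ℂ] B i) (i : I) (a : A) :
    eval i (pi f a) = f i a := rfl

end CStarProd

/-- The `C*`-subalgebra generated by a set. -/
def generatedCStar {A : Type*} [CStarAlgebra A] (s : Set A) : StarSubalgebra ℂ A :=
  (StarAlgebra.adjoin ℂ s).topologicalClosure

theorem isClosed_generatedCStar {A : Type*} [CStarAlgebra A] (s : Set A) :
    IsClosed (generatedCStar s : Set A) := StarSubalgebra.isClosed_topologicalClosure _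

theorem subset_generatedCStar {A : Type*} [CStarAlgebra A] (s : Set A) {a : A} (ha : a ∈ s) :
    a ∈ generatedCStar s :=
  StarSubalgebra.le_topologicalClosure _ (StarAlgebra.subset_adjoin ℂ s ha)

/-- A `*`-homomorphism maps the `C*`-subalgebra generated by `s` into that generated by `t` if it
maps `s` to `t`. -/
theorem map_generatedCStar {A B : Type*} [CStarAlgebra A] [CStarAlgebra B] (f : A →⋆ₐ[ℂ] B)
    {s : Set A} {t : Set B} (h : ∀ a ∈ s, f a ∈ t) {a : A} (ha : a ∈ generatedCStar s) :
    f a ∈ generatedCStar t := by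
  have h₁ : StarAlgebra.adjoin ℂ s ≤ (generatedCStar t).comap f :=
    StarAlgebra.adjoin_le fun a ha => subset_generatedCStar t (h a ha)
  exact StarSubalgebra.topologicalClosure_minimal h₁
    ((isClosed_generatedCStar t).preimage (continuous_starAlgHom f)) ha

/-- Two `*`-homomorphisms agree on the `C*`-subalgebra generated by `s` if they agree on `s`. -/
theorem eqOn_generatedCStar {A B : Type*} [CStarAlgebra A] [CStarAlgebra B] (f g : A →⋆ₐ[ℂ] B)
    {s : Set A} (h : ∀ a ∈ s, f a = g a) {a : A} (ha : a ∈ generatedCStar s) : f a = g a := by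
  have h₁ : StarAlgebra.adjoin ℂ s ≤ StarAlgHom.equalizer f g := StarAlgebra.adjoin_le h
  exact StarSubalgebra.topologicalClosure_minimal h₁
    (isClosed_eq (continuous_starAlgHom f) (continuous_starAlgHom g)) ha

/-- The `C*`-subalgebra generated by a set, as a `C*`-algebra. -/
def GeneratedCStar {A : Type*} [CStarAlgebra A] (s : Set A) : Type _ := generatedCStar s

namespace GeneratedCStar

variable {A B C : Type*} [CStarAlgebra A] [CStarAlgebra B] [CStarAlgebra C]

instance (s : Set A) : CStarAlgebra (GeneratedCStar s) :=
  StarSubalgebra.cstarAlgebra (generatedCStar s) (h_closed := isClosed_generatedCStar s)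

/-- The inclusion. -/
def incl (s : Set A) : GeneratedCStar s →⋆ₐ[ℂ] A := (generatedCStar s).subtype

theorem incl_injective (s : Set A) : Function.Injective (incl s) := Subtype.val_injective

theorem incl_mem (s : Set A) (a : GeneratedCStar s) : incl s a ∈ generatedCStar s := a.2

/-- Restriction of the codomain of a `*`-homomorphism. -/
def codRestrict (s : Set A) (f : C →⋆ₐ[ℂ] A) (hf : ∀ c, f c ∈ generatedCStar s) :
    C →⋆ₐ[ℂ] GeneratedCStar s := StarAlgHom.codRestrict f (generatedCStar s) hf

@[simp]
theorem incl_codRestrict (s : Set A) (f : C →⋆ₐ[ℂ] A) (hf : ∀ c, f c ∈ generatedCStar s) (c : C) :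
    incl s (codRestrict s f hf c) = f c := rfl

/-- The restriction of a `*`-homomorphism to generated `C*`-subalgebras. -/
def map (s : Set A) (t : Set B) (f : A →⋆ₐ[ℂ] B) (h : ∀ a ∈ s, f a ∈ t) :
    GeneratedCStar s →⋆ₐ[ℂ] GeneratedCStar t :=
  codRestrict t (f.comp (incl s)) fun a => map_generatedCStar f h (incl_mem s a)

@[simp]
theorem incl_map (s : Set A) (t : Set B) (f : A →⋆ₐ[ℂ] B) (h : ∀ a ∈ s, f a ∈ t)
    (a : GeneratedCStar s) : incl t (map s t f h a) = f (incl s a) := rfl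

end GeneratedCStar

/-- Conjugation with a unitary, as a `*`-homomorphism `T ↦ e T e⁻¹`. -/
def conjHom {E F : Type*} [NormedAddCommGroup E] [InnerProductSpace ℂ E] [CompleteSpace E]
    [NormedAddCommGroup F] [InnerProductSpace ℂ F] [CompleteSpace F] (e : E ≃ₗᵢ[ℂ] F) :
    (E →L[ℂ] E) →⋆ₐ[ℂ] (F →L[ℂ] F) where
  toFun := e.conjStarAlgEquiv
  map_one' := map_one _
  map_mul' := map_mul _
  map_zero' := map_zero _
  map_add' := map_add _
  commutes' c := by
    ext x
    simp [Algebra.algebraMap_eq_smul_one]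
  map_star' := map_star _

theorem conjHom_apply {E F : Type*} [NormedAddCommGroup E] [InnerProductSpace ℂ E]
    [CompleteSpace E] [NormedAddCommGroup F] [InnerProductSpace ℂ F] [CompleteSpace F]
    (e : E ≃ₗᵢ[ℂ] F) (T : E →L[ℂ] E) (x : F) : conjHom e T x = e (T (e.symm x)) := rfl

variable {N : ℕ} [NeZero N] {ω : ℂ} (hω : IsPrimitiveRoot ω N)
variable {X : Type u} {Y : Type v} [CStarAlgebra X] [CStarAlgebra Y]

/-- The operators on the Hilbert space `L^X ⊗ L^Y`, for a pair of covariant representations. -/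
abbrev PairOp {ρX : Coaction N X} {ρY : Coaction N Y} (i : CovRep ρX × CovRep ρY) : Type _ :=
  HTensor i.1.H i.2.H →L[ℂ] HTensor i.1.H i.2.H

/-- The `C*`-algebra of bounded families of operators on the Hilbert spaces `L^X ⊗ L^Y`, over all
pairs of covariant representations of `X` on `L^X` and of `Y` on `L^Y`. -/
def BraidedAmbient (ρX : Coaction N X) (ρY : Coaction N Y) : Type _ :=
  CStarProd (PairOp (ρX := ρX) (ρY := ρY))

instance (ρX : Coaction N X) (ρY : Coaction N Y) : CStarAlgebra (BraidedAmbient ρX ρY) :=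
  inferInstanceAs (CStarAlgebra (CStarProd (PairOp (ρX := ρX) (ρY := ρY))))

/-- The representation `x ↦ x ⊗ 1` of `X` on `L^X ⊗ L^Y`. -/
def j₁Rep {ρX : Coaction N X} {ρY : Coaction N Y} (i : CovRep ρX × CovRep ρY) :
    X →⋆ₐ[ℂ] PairOp i :=
  (ampl i.2.H).comp i.1.rep

/-- The representation `y ↦ c⁻¹ (y ⊗ 1) c` of `Y` on `L^X ⊗ L^Y`, for the braiding unitary
`c : L^X ⊗ L^Y → L^Y ⊗ L^X`. -/
def j₂Rep {ρX : Coaction N X} {ρY : Coaction N Y} (i : CovRep ρX × CovRep ρY) :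
    Y →⋆ₐ[ℂ] PairOp i :=
  (conjHom (braiding hω i.1.U i.2.U).symm).comp ((ampl i.1.H).comp i.2.rep)

/-- The map `j₁` with values in the families of operators. -/
def j₁Amb (ρX : Coaction N X) (ρY : Coaction N Y) : X →⋆ₐ[ℂ] BraidedAmbient ρX ρY :=
  CStarProd.pi (B := PairOp (ρX := ρX) (ρY := ρY)) j₁Rep

/-- The map `j₂` with values in the families of operators. -/
def j₂Amb (ρX : Coaction N X) (ρY : Coaction N Y) : Y →⋆ₐ[ℂ] BraidedAmbient ρX ρY :=
  CStarProd.pi (B := PairOp (ρX := ρX) (ρY := ρY)) (j₂Rep hω)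

/-- The set of the elements `j₁(x) j₂(y)`. -/
def braidedProducts (ρX : Coaction N X) (ρY : Coaction N Y) : Set (BraidedAmbient ρX ρY) :=
  {a | ∃ (x : X) (y : Y), a = j₁Amb ρX ρY x * j₂Amb hω ρX ρY y}

/-- The braided tensor product `X ⊠ Y`, the `C*`-algebra that is generated by the elements
`j₁(x) j₂(y)` with `j₁(x) = x ⊗ 1` and `j₂(y) = c⁻¹ (y ⊗ 1) c`.  For every pair of covariant
representations of `X` on `L^X` and of `Y` on `L^Y` it is represented on `L^X ⊗ L^Y`, and its norm
is the supremum of the norms in these representations.  The representation given by a pair of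
faithful covariant representations is isometric, so this is the `C*`-subalgebra of
`B(L^X ⊗ L^Y)` generated by the `j₁(x) j₂(y)` for any such pair. -/
def BraidedTensor (ρX : Coaction N X) (ρY : Coaction N Y) : Type _ :=
  GeneratedCStar (braidedProducts hω ρX ρY)

instance (ρX : Coaction N X) (ρY : Coaction N Y) : CStarAlgebra (BraidedTensor hω ρX ρY) :=
  inferInstanceAs (CStarAlgebra (GeneratedCStar (braidedProducts hω ρX ρY)))

namespace BraidedTensor

section

variable (ρX : Coaction N X) (ρY : Coaction N Y)

/-- The embedding of the first factor. -/
def j₁ : X →⋆ₐ[ℂ] BraidedTensor hω ρX ρY :=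
  GeneratedCStar.codRestrict (braidedProducts hω ρX ρY) (j₁Amb ρX ρY) fun x =>
    subset_generatedCStar _ ⟨x, 1, by rw [map_one, mul_one]⟩

/-- The embedding of the second factor. -/
def j₂ : Y →⋆ₐ[ℂ] BraidedTensor hω ρX ρY :=
  GeneratedCStar.codRestrict (braidedProducts hω ρX ρY) (j₂Amb hω ρX ρY) fun y =>
    subset_generatedCStar _ ⟨1, y, by rw [map_one, one_mul]⟩

/-- The representation of `X ⊠ Y` on `L^X ⊗ L^Y`. -/
def toRep (i : CovRep ρX × CovRep ρY) : BraidedTensor hω ρX ρY →⋆ₐ[ℂ] PairOp i :=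
  (CStarProd.eval (B := PairOp (ρX := ρX) (ρY := ρY)) i).comp
    (GeneratedCStar.incl (braidedProducts hω ρX ρY))

@[simp]
theorem toRep_j₁ (i : CovRep ρX × CovRep ρY) (x : X) :
    toRep hω ρX ρY i (j₁ hω ρX ρY x) = j₁Rep i x := rfl

@[simp]
theorem toRep_j₂ (i : CovRep ρX × CovRep ρY) (y : Y) :
    toRep hω ρX ρY i (j₂ hω ρX ρY y) = j₂Rep hω i y := rfl

end

variable {ρX : Coaction N X} {ρY : Coaction N Y}

theorem ext_rep {a b : BraidedTensor hω ρX ρY}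
    (h : ∀ i, toRep hω ρX ρY i a = toRep hω ρX ρY i b) : a = b :=
  GeneratedCStar.incl_injective (braidedProducts hω ρX ρY)
    (CStarProd.ext (B := PairOp (ρX := ρX) (ρY := ρY)) h)

theorem j₂Rep_tmul (i : CovRep ρX × CovRep ρY) {e : ZMod N} {y : Y}
    (hy : IsHomogeneous ω ρY e y) (ξ : i.1.H) (η : i.2.H) :
    j₂Rep hω i y (ξ ⊗ₜ[ℂ] η : i.1.H ⊗[ℂ] i.2.H) =
      (i.1.U (.ofAdd (-e)) ξ ⊗ₜ[ℂ] i.2.rep y η : i.1.H ⊗[ℂ] i.2.H) := by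
  change (braiding hω i.1.U i.2.U).symm (ampl i.1.H (i.2.rep y)
    ((braiding hω i.1.U i.2.U).symm.symm (ξ ⊗ₜ[ℂ] η : i.1.H ⊗[ℂ] i.2.H))) = _
  rw [LinearIsometryEquiv.symm_symm, LinearIsometryEquiv.symm_apply_eq, braiding_tmul,
    braiding_tmul]
  have h : ∀ z : i.2.H ⊗[ℂ] i.1.H, ampl i.1.H (i.2.rep y) (z : HTensor i.2.H i.1.H) =
      ((i.2.rep y).rTensor i.1.H z : i.2.H ⊗[ℂ] i.1.H) := fun z =>
    ContinuousLinearMap.completion_apply_coe _ z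
  rw [h, map_sum]
  congr 1
  refine Finset.sum_congr rfl fun m _ => ?_
  rw [ContinuousLinearMap.rTensor_tmul, i.2.covariant, hy, map_smul,
    degreeProj_unitary hω, smul_apply, TensorProduct.smul_tmul, smul_smul,
    ← chi_add hω]
  have h0 : m * e + -e * m = 0 := by ring
  rw [h0, chi_zero, one_smul]

/-- The commutation relation between the two factors, for homogeneous elements. -/
theorem j₁_mul_j₂ {d e : ZMod N} {x : X} {y : Y} (hx : IsHomogeneous ω ρX d x)
    (hy : IsHomogeneous ω ρY e y) :
    j₁ hω ρX ρY x * j₂ hω ρX ρY y = chi ω (d * e) • (j₂ hω ρX ρY y * j₁ hω ρX ρY x) := by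
  refine ext_rep hω fun i => ?_
  rw [map_smul, map_mul, map_mul, toRep_j₁, toRep_j₂]
  refine HTensor.ext fun ξ η => ?_
  rw [mul_apply_eq_comp, smul_apply,
    mul_apply_eq_comp, j₂Rep_tmul hω i hy]
  change ampl i.2.H (i.1.rep x) _ = chi ω (d * e) • j₂Rep hω i y (ampl i.2.H (i.1.rep x) _)
  rw [ampl_tmul, ampl_tmul, j₂Rep_tmul hω i hy, i.1.covariant, hx, map_smul,
    smul_apply, ← TensorProduct.smul_tmul', Completion.coe_smul, smul_smul,
    ← chi_add hω]
  have h0 : d * e + -e * d = 0 := by ring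
  rw [h0, chi_zero, one_smul]

section map

variable {X' : Type u} {Y' : Type v} [CStarAlgebra X'] [CStarAlgebra Y']
  {ρX' : Coaction N X'} {ρY' : Coaction N Y'}

/-- Restriction of a family to the pull-backs of the covariant representations along `φ` and `ψ`. -/
def ambientMap (φ : EquivariantHom ρX ρX') (ψ : EquivariantHom ρY ρY') :
    BraidedAmbient ρX ρY →⋆ₐ[ℂ] BraidedAmbient ρX' ρY' :=
  CStarProd.pi (B := PairOp (ρX := ρX') (ρY := ρY')) fun i =>
    CStarProd.eval (B := PairOp (ρX := ρX) (ρY := ρY)) (i.1.comap φ, i.2.comap ψ)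

theorem ambientMap_j₁ (φ : EquivariantHom ρX ρX') (ψ : EquivariantHom ρY ρY') (x : X) :
    ambientMap φ ψ (j₁Amb ρX ρY x) = j₁Amb ρX' ρY' (φ x) := rfl

theorem ambientMap_j₂ (φ : EquivariantHom ρX ρX') (ψ : EquivariantHom ρY ρY') (y : Y) :
    ambientMap φ ψ (j₂Amb hω ρX ρY y) = j₂Amb hω ρX' ρY' (ψ y) := rfl

/-- The morphism `φ ⊠ ψ`, with `(φ ⊠ ψ)(j₁(x) j₂(y)) = j₁(φ(x)) j₂(ψ(y))`. -/
def map (φ : EquivariantHom ρX ρX') (ψ : EquivariantHom ρY ρY') :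
    BraidedTensor hω ρX ρY →⋆ₐ[ℂ] BraidedTensor hω ρX' ρY' :=
  GeneratedCStar.map (braidedProducts hω ρX ρY) (braidedProducts hω ρX' ρY') (ambientMap φ ψ) (by
    rintro _ ⟨x, y, rfl⟩
    exact ⟨φ x, ψ y, by rw [map_mul, ambientMap_j₁, ambientMap_j₂]⟩)

@[simp]
theorem map_j₁ (φ : EquivariantHom ρX ρX') (ψ : EquivariantHom ρY ρY') (x : X) :
    map hω φ ψ (j₁ hω ρX ρY x) = j₁ hω ρX' ρY' (φ x) := rfl

@[simp]
theorem map_j₂ (φ : EquivariantHom ρX ρX') (ψ : EquivariantHom ρY ρY') (y : Y) :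
    map hω φ ψ (j₂ hω ρX ρY y) = j₂ hω ρX' ρY' (ψ y) := rfl

end map

end BraidedTensor

end BraidedTensor

/-! ### Anyonic permutation matrices and anyonic unitary matrices -/

section Relations

set_option linter.unusedSectionVars false

variable {N : ℕ} [NeZero N] {B C : Type*} [Ring B] [StarRing B] [Algebra ℂ B] [Ring C]
  [StarRing C] [Algebra ℂ C]

/-- The relators of the anyonic quantum permutation group: the differences of both sides of the
relations `q₀ᵢ = δᵢ₀`, `qᵢ₀ = δᵢ₀`, `qᵢⱼ* = ω ^ (-i (i - j)) q₋ᵢ,₋ⱼ`,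
`qₖ,ᵢ₊ⱼ = ∑ₗ ω ^ (-l (i - k + l)) qₖ₋ₗ,ᵢ qₗⱼ` and
`qᵢ₊ⱼ,ₖ = ∑ₗ ω ^ (-i (l - j)) qⱼₗ qᵢ,ₖ₋ₗ`. -/
def permRelators (ω : ℂ) (q : Matrix (ZMod N) (ZMod N) B) : Set B :=
  {r | (∃ i, r = q 0 i - if i = 0 then 1 else 0) ∨
    (∃ i, r = q i 0 - if i = 0 then 1 else 0) ∨
    (∃ i j, r = star (q i j) - chi ω (-(i * (i - j))) • q (-i) (-j)) ∨
    (∃ i j k, r = q k (i + j) -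
      ∑ l, chi ω (-(l * (i - k + l))) • (q (k - l) i * q l j)) ∨
    (∃ i j k, r = q (i + j) k - ∑ l, chi ω (-(i * (l - j))) • (q j l * q i (k - l)))}

/-- The matrix `(ω ^ (-i (j - i)) uᵢⱼ*)`. -/
def twistConj (ω : ℂ) (u : Matrix (ZMod N) (ZMod N) B) : Matrix (ZMod N) (ZMod N) B :=
  Matrix.of fun i j => chi ω (-(i * (j - i))) • star (u i j)

theorem twistConj_apply (ω : ℂ) (u : Matrix (ZMod N) (ZMod N) B) (i j : ZMod N) :
    twistConj ω u i j = chi ω (-(i * (j - i))) • star (u i j) := rfl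

/-- The relators of the anyonic free unitary quantum group: the entries of `u* u - 1` and
`u u* - 1`, and the same for `twistConj ω u` instead of `u`. -/
def unitaryRelators (ω : ℂ) (u : Matrix (ZMod N) (ZMod N) B) : Set B :=
  {r | ∃ i j, r = (star u * u - 1) i j ∨ r = (u * star u - 1) i j ∨
    r = (star (twistConj ω u) * twistConj ω u - 1) i j ∨
    r = (twistConj ω u * star (twistConj ω u) - 1) i j}

/-- The matrices that satisfy the relations of the anyonic quantum permutation group. -/
structure IsAnyonicPerm (ω : ℂ) (q : Matrix (ZMod N) (ZMod N) B) : Prop where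
  zero_left : ∀ i, q 0 i = if i = 0 then 1 else 0
  zero_right : ∀ i, q i 0 = if i = 0 then 1 else 0
  star_eq : ∀ i j, star (q i j) = chi ω (-(i * (i - j))) • q (-i) (-j)
  right_add : ∀ i j k, q k (i + j) = ∑ l, chi ω (-(l * (i - k + l))) • (q (k - l) i * q l j)
  left_add : ∀ i j k, q (i + j) k = ∑ l, chi ω (-(i * (l - j))) • (q j l * q i (k - l))

/-- The matrices that satisfy the relations of the anyonic free unitary quantum group. -/
structure IsAnyonicUnitary (ω : ℂ) (u : Matrix (ZMod N) (ZMod N) B) : Prop where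
  unitary : u ∈ unitary (Matrix (ZMod N) (ZMod N) B)
  unitary_twist : twistConj ω u ∈ _root_.unitary (Matrix (ZMod N) (ZMod N) B)

theorem permRelators_eq_zero {ω : ℂ} {q : Matrix (ZMod N) (ZMod N) B} :
    (∀ r ∈ permRelators ω q, r = 0) ↔ IsAnyonicPerm ω q := by
  constructor
  · intro h
    refine ⟨fun i => sub_eq_zero.mp (h _ ?_), fun i => sub_eq_zero.mp (h _ ?_),
      fun i j => sub_eq_zero.mp (h _ ?_), fun i j k => sub_eq_zero.mp (h _ ?_),
      fun i j k => sub_eq_zero.mp (h _ ?_)⟩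
    · exact .inl ⟨i, rfl⟩
    · exact .inr (.inl ⟨i, rfl⟩)
    · exact .inr (.inr (.inl ⟨i, j, rfl⟩))
    · exact .inr (.inr (.inr (.inl ⟨i, j, k, rfl⟩)))
    · exact .inr (.inr (.inr (.inr ⟨i, j, k, rfl⟩)))
  · rintro h r (⟨i, rfl⟩ | ⟨i, rfl⟩ | ⟨i, j, rfl⟩ | ⟨i, j, k, rfl⟩ | ⟨i, j, k, rfl⟩) <;>
      rw [sub_eq_zero]
    exacts [h.zero_left i, h.zero_right i, h.star_eq i j, h.right_add i j k, h.left_add i j k]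

theorem unitaryRelators_eq_zero {ω : ℂ} {u : Matrix (ZMod N) (ZMod N) B} :
    (∀ r ∈ unitaryRelators ω u, r = 0) ↔ IsAnyonicUnitary ω u := by
  constructor
  · intro h
    refine ⟨Unitary.mem_iff.mpr ⟨?_, ?_⟩, Unitary.mem_iff.mpr ⟨?_, ?_⟩⟩ <;>
      refine sub_eq_zero.mp (Matrix.ext fun i j => h _ ⟨i, j, ?_⟩)
    exacts [.inl rfl, .inr (.inl rfl), .inr (.inr (.inl rfl)), .inr (.inr (.inr rfl))]
  · rintro h r ⟨i, j, rfl | rfl | rfl | rfl⟩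
    · rw [Unitary.star_mul_self_of_mem h.unitary, sub_self]; rfl
    · rw [Unitary.mul_star_self_of_mem h.unitary, sub_self]; rfl
    · rw [Unitary.star_mul_self_of_mem h.unitary_twist, sub_self]; rfl
    · rw [Unitary.mul_star_self_of_mem h.unitary_twist, sub_self]; rfl

theorem map_permRelators (f : B →⋆ₐ[ℂ] C) {ω : ℂ} {q : Matrix (ZMod N) (ZMod N) B} :
    (∀ r ∈ permRelators ω q, f r = 0) ↔ IsAnyonicPerm ω (q.map f) := by
  rw [← permRelators_eq_zero]
  constructor
  · rintro h r (⟨i, rfl⟩ | ⟨i, rfl⟩ | ⟨i, j, rfl⟩ | ⟨i, j, k, rfl⟩ | ⟨i, j, k, rfl⟩)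
    · simpa [apply_ite f] using h _ (.inl ⟨i, rfl⟩)
    · simpa [apply_ite f] using h _ (.inr (.inl ⟨i, rfl⟩))
    · simpa [map_star] using h _ (.inr (.inr (.inl ⟨i, j, rfl⟩)))
    · simpa using h _ (.inr (.inr (.inr (.inl ⟨i, j, k, rfl⟩))))
    · simpa using h _ (.inr (.inr (.inr (.inr ⟨i, j, k, rfl⟩))))
  · rintro h r (⟨i, rfl⟩ | ⟨i, rfl⟩ | ⟨i, j, rfl⟩ | ⟨i, j, k, rfl⟩ | ⟨i, j, k, rfl⟩)
    · simpa [apply_ite f] using h _ (.inl ⟨i, rfl⟩)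
    · simpa [apply_ite f] using h _ (.inr (.inl ⟨i, rfl⟩))
    · simpa [map_star] using h _ (.inr (.inr (.inl ⟨i, j, rfl⟩)))
    · simpa using h _ (.inr (.inr (.inr (.inl ⟨i, j, k, rfl⟩))))
    · simpa using h _ (.inr (.inr (.inr (.inr ⟨i, j, k, rfl⟩))))

theorem star_map (f : B →⋆ₐ[ℂ] C) (u : Matrix (ZMod N) (ZMod N) B) :
    star (u.map f) = (star u).map f := Matrix.ext fun i j => (map_star f (u j i)).symm

theorem twistConj_map (f : B →⋆ₐ[ℂ] C) (ω : ℂ) (u : Matrix (ZMod N) (ZMod N) B) :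
    twistConj ω (u.map f) = (twistConj ω u).map f := Matrix.ext fun i j => by
  simp [twistConj_apply, map_star]

theorem map_unitaryRelators (f : B →⋆ₐ[ℂ] C) {ω : ℂ} {u : Matrix (ZMod N) (ZMod N) B} :
    (∀ r ∈ unitaryRelators ω u, f r = 0) ↔ IsAnyonicUnitary ω (u.map f) := by
  rw [← unitaryRelators_eq_zero]
  have key : ∀ a b : Matrix (ZMod N) (ZMod N) B, ∀ i j,
      (a.map f * b.map f - 1) i j = f ((a * b - 1) i j) := fun a b i j => by
    rw [Matrix.sub_apply, Matrix.sub_apply, map_sub]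
    congr 1
    · simp [Matrix.mul_apply]
    · simp [Matrix.one_apply, apply_ite f]
  constructor
  · rintro h r ⟨i, j, hr⟩
    rw [twistConj_map, star_map, star_map, key, key, key, key] at hr
    rcases hr with rfl | rfl | rfl | rfl <;> refine h _ ⟨i, j, ?_⟩ <;> tauto
  · rintro h r ⟨i, j, hr⟩
    refine h _ ⟨i, j, ?_⟩
    rw [twistConj_map, star_map, star_map, key, key, key, key]
    rcases hr with rfl | rfl | rfl | rfl <;> tauto

theorem map_mem_unitary (f : B →⋆ₐ[ℂ] C) {u : Matrix (ZMod N) (ZMod N) B}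
    (h : u ∈ unitary (Matrix (ZMod N) (ZMod N) B)) :
    u.map f ∈ unitary (Matrix (ZMod N) (ZMod N) C) := by
  have h1 : (1 : Matrix (ZMod N) (ZMod N) B).map f = 1 :=
    Matrix.map_one f (map_zero f) (map_one f)
  refine Unitary.mem_iff.mpr ⟨?_, ?_⟩
  · rw [star_map, ← Matrix.map_mul, Unitary.star_mul_self_of_mem h, h1]
  · rw [star_map, ← Matrix.map_mul, Unitary.mul_star_self_of_mem h, h1]

theorem IsAnyonicPerm.map (f : B →⋆ₐ[ℂ] C) {ω : ℂ} {q : Matrix (ZMod N) (ZMod N) B}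
    (h : IsAnyonicPerm ω q) : IsAnyonicPerm ω (q.map f) :=
  (map_permRelators f).mp fun r hr => by rw [permRelators_eq_zero.mpr h r hr, map_zero]

theorem IsAnyonicUnitary.map (f : B →⋆ₐ[ℂ] C) {ω : ℂ} {u : Matrix (ZMod N) (ZMod N) B}
    (h : IsAnyonicUnitary ω u) : IsAnyonicUnitary ω (u.map f) :=
  (map_unitaryRelators f).mp fun r hr => by rw [unitaryRelators_eq_zero.mpr h r hr, map_zero]

section twist

variable {ω : ℂ}

/-- The relations of the anyonic quantum permutation group are homogeneous. -/
theorem IsAnyonicPerm.smul (hω : IsPrimitiveRoot ω N)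
    [StarModule ℂ B] {q : Matrix (ZMod N) (ZMod N) B}
    (h : IsAnyonicPerm ω q) (t : ZMod N) :
    IsAnyonicPerm ω (Matrix.of fun i j => chi ω (t * (j - i)) • q i j) := by
  refine ⟨fun i => ?_, fun i => ?_, fun i j => ?_, fun i j k => ?_, fun i j k => ?_⟩
  · rw [Matrix.of_apply, h.zero_left]
    split_ifs with hi
    · rw [hi, sub_zero, mul_zero, chi_zero, one_smul]
    · rw [smul_zero]
  · rw [Matrix.of_apply, h.zero_right]
    split_ifs with hi
    · rw [hi, sub_zero, mul_zero, chi_zero, one_smul]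
    · rw [smul_zero]
  · rw [Matrix.of_apply, Matrix.of_apply, star_smul, h.star_eq, chi_star hω, smul_smul, smul_smul,
      ← chi_add hω, ← chi_add hω]
    congr 2; ring
  · rw [Matrix.of_apply, h.right_add, Finset.smul_sum]
    refine Finset.sum_congr rfl fun l _ => ?_
    rw [Matrix.of_apply, Matrix.of_apply, smul_mul_smul_comm, smul_smul, smul_smul, ← chi_add hω,
      ← chi_add hω, ← chi_add hω]
    congr 2; ring
  · rw [Matrix.of_apply, h.left_add, Finset.smul_sum]
    refine Finset.sum_congr rfl fun l _ => ?_
    rw [Matrix.of_apply, Matrix.of_apply, smul_mul_smul_comm, smul_smul, smul_smul, ← chi_add hω,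
      ← chi_add hω, ← chi_add hω]
    congr 2; ring

theorem smul_mem_unitary (hω : IsPrimitiveRoot ω N)
    [StarModule ℂ B] {u : Matrix (ZMod N) (ZMod N) B}
    (h : u ∈ unitary (Matrix (ZMod N) (ZMod N) B)) (t : ZMod N) :
    (Matrix.of fun i j => chi ω (t * (j - i)) • u i j) ∈
      unitary (Matrix (ZMod N) (ZMod N) B) := by
  refine Unitary.mem_iff.mpr ⟨Matrix.ext fun i j => ?_, Matrix.ext fun i j => ?_⟩
  · have h₁ : star u * u = 1 := Unitary.star_mul_self_of_mem h
    have h' := congrFun (congrFun h₁ i) j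
    rw [Matrix.mul_apply, Matrix.one_apply] at h' ⊢
    have h₂ : (if i = j then (1 : B) else 0) = chi ω (t * (j - i)) • if i = j then 1 else 0 := by
      split_ifs with hi
      · rw [hi, sub_self, mul_zero, chi_zero, one_smul]
      · rw [smul_zero]
    rw [h₂, ← h', Finset.smul_sum]
    refine Finset.sum_congr rfl fun l _ => ?_
    rw [Matrix.star_apply, Matrix.star_apply, Matrix.of_apply, Matrix.of_apply, star_smul,
      smul_mul_smul_comm, chi_star hω, ← chi_add hω]
    congr 2; ring
  · have h₁ : u * star u = 1 := Unitary.mul_star_self_of_mem h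
    have h' := congrFun (congrFun h₁ i) j
    rw [Matrix.mul_apply, Matrix.one_apply] at h' ⊢
    have h₂ : (if i = j then (1 : B) else 0) = chi ω (t * (j - i)) • if i = j then 1 else 0 := by
      split_ifs with hi
      · rw [hi, sub_self, mul_zero, chi_zero, one_smul]
      · rw [smul_zero]
    rw [h₂, ← h', Finset.smul_sum]
    refine Finset.sum_congr rfl fun l _ => ?_
    rw [Matrix.star_apply, Matrix.star_apply, Matrix.of_apply, Matrix.of_apply, star_smul,
      smul_mul_smul_comm, chi_star hω, ← chi_add hω]
    congr 2; ring

/-- The relations of the anyonic free unitary quantum group are homogeneous. -/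
theorem IsAnyonicUnitary.smul (hω : IsPrimitiveRoot ω N)
    [StarModule ℂ B] {u : Matrix (ZMod N) (ZMod N) B}
    (h : IsAnyonicUnitary ω u) (t : ZMod N) :
    IsAnyonicUnitary ω (Matrix.of fun i j => chi ω (t * (j - i)) • u i j) := by
  refine ⟨smul_mem_unitary hω h.unitary t, ?_⟩
  have h' := smul_mem_unitary hω h.unitary_twist (-t)
  have h₂ : twistConj ω (Matrix.of fun i j => chi ω (t * (j - i)) • u i j) =
      Matrix.of fun i j => chi ω (-t * (j - i)) • twistConj ω u i j := by
    ext i j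
    rw [twistConj_apply, Matrix.of_apply, Matrix.of_apply, twistConj_apply, star_smul,
      chi_star hω, smul_smul, smul_smul, ← chi_add hω, ← chi_add hω]
    congr 2; ring
  rwa [h₂]

/-- The product of two anyonic permutation matrices with braided commuting entries. -/
theorem IsAnyonicPerm.mul (hω : IsPrimitiveRoot ω N)
    [StarModule ℂ B] {a b : Matrix (ZMod N) (ZMod N) B}
    (ha : IsAnyonicPerm ω a) (hb : IsAnyonicPerm ω b)
    (hab : ∀ i j k l, a i j * b k l = chi ω ((j - i) * (l - k)) • (b k l * a i j)) :
    IsAnyonicPerm ω (a * b) := by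
  have hba : ∀ i j k l, b k l * a i j = chi ω (-((j - i) * (l - k))) • (a i j * b k l) :=
    fun i j k l => by rw [hab, smul_smul, chi_neg_mul_self hω, one_smul]
  refine ⟨fun i => ?_, fun i => ?_, fun i j => ?_, fun i j k => ?_, fun i j k => ?_⟩
  · simp [Matrix.mul_apply, ha.zero_left, hb.zero_left]
  · simp [Matrix.mul_apply, ha.zero_right, hb.zero_right]
  · rw [Matrix.mul_apply, Matrix.mul_apply, star_sum, Finset.smul_sum,
      ← Equiv.sum_comp (Equiv.neg (ZMod N)) fun k => chi ω (-(i * (i - j))) •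
        (a (-i) k * b k (-j))]
    refine Finset.sum_congr rfl fun k _ => ?_
    rw [star_mul, ha.star_eq, hb.star_eq, smul_mul_smul_comm, hba, smul_smul, ← chi_add hω,
      ← chi_add hω]
    rw [Equiv.neg_apply]
    congr 2; ring
  · have h₁ : ∀ l, chi ω (-(l * (i - k + l))) • ((a * b) (k - l) i * (a * b) l j) =
        ∑ α, ∑ β, chi ω (-((i - α) * β)) •
          ((chi ω (-(l * (α - k + l))) • (a (k - l) α * a l β)) * (b α i * b β j)) := by
      intro l
      rw [Matrix.mul_apply, Matrix.mul_apply, Finset.sum_mul_sum, Finset.smul_sum]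
      refine Finset.sum_congr rfl fun α _ => ?_
      rw [Finset.smul_sum]
      refine Finset.sum_congr rfl fun β _ => ?_
      have h₂ : a (k - l) α * b α i * (a l β * b β j) =
          a (k - l) α * (b α i * a l β) * b β j := by simp only [mul_assoc]
      rw [h₂, hba, mul_smul_comm, smul_mul_assoc, smul_mul_assoc, smul_smul, smul_smul,
        ← chi_add hω, ← chi_add hω]
      congr 1
      · congr 1; ring
      · simp only [mul_assoc]
    simp only [h₁]
    rw [Finset.sum_comm]
    have h₃ : ∀ α, ∑ l, ∑ β, chi ω (-((i - α) * β)) •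
          ((chi ω (-(l * (α - k + l))) • (a (k - l) α * a l β)) * (b α i * b β j)) =
        ∑ β, chi ω (-((i - α) * β)) • (a k (α + β) * (b α i * b β j)) := by
      intro α
      rw [Finset.sum_comm]
      refine Finset.sum_congr rfl fun β _ => ?_
      rw [← Finset.smul_sum, ← Finset.sum_mul, ← ha.right_add]
    simp only [h₃]
    rw [Finset.sum_comm, Matrix.mul_apply]
    simp only [hb.right_add, Finset.mul_sum]
    rw [Finset.sum_comm]
    refine Finset.sum_congr rfl fun β _ => ?_
    rw [← Equiv.sum_comp (Equiv.addRight β)]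
    refine Finset.sum_congr rfl fun α _ => ?_
    rw [Equiv.coe_addRight, add_sub_cancel_right, mul_smul_comm]
    congr 2; ring
  · have h₁ : ∀ l, chi ω (-(i * (l - j))) • ((a * b) j l * (a * b) i (k - l)) =
        ∑ α, ∑ β, chi ω (-(i * (α - j))) •
          ((a j α * a i β) * (chi ω (-(β * (l - α))) • (b α l * b β (k - l)))) := by
      intro l
      rw [Matrix.mul_apply, Matrix.mul_apply, Finset.sum_mul_sum, Finset.smul_sum]
      refine Finset.sum_congr rfl fun α _ => ?_
      rw [Finset.smul_sum]
      refine Finset.sum_congr rfl fun β _ => ?_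
      have h₂ : a j α * b α l * (a i β * b β (k - l)) =
          a j α * (b α l * a i β) * b β (k - l) := by simp only [mul_assoc]
      rw [h₂, hba, mul_smul_comm, smul_mul_assoc, mul_smul_comm, smul_smul, smul_smul,
        ← chi_add hω, ← chi_add hω]
      congr 1
      · congr 1; ring
      · simp only [mul_assoc]
    simp only [h₁]
    rw [Finset.sum_comm]
    have h₃ : ∀ α, ∑ l, ∑ β, chi ω (-(i * (α - j))) •
          ((a j α * a i β) * (chi ω (-(β * (l - α))) • (b α l * b β (k - l)))) =
        ∑ β, chi ω (-(i * (α - j))) • ((a j α * a i β) * b (α + β) k) := by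
      intro α
      rw [Finset.sum_comm]
      refine Finset.sum_congr rfl fun β _ => ?_
      rw [← Finset.smul_sum, ← Finset.mul_sum, ← hb.left_add, add_comm]
    simp only [h₃]
    rw [Matrix.mul_apply]
    simp only [ha.left_add, Finset.sum_mul]
    rw [Finset.sum_comm]
    refine Finset.sum_congr rfl fun α _ => ?_
    rw [← Equiv.sum_comp (Equiv.addLeft α)]
    refine Finset.sum_congr rfl fun β _ => ?_
    rw [Equiv.coe_addLeft, add_sub_cancel_left, smul_mul_assoc]

/-- The product of two anyonic unitary matrices with braided commuting entries. -/
theorem IsAnyonicUnitary.mul (hω : IsPrimitiveRoot ω N)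
    [StarModule ℂ B] {a b : Matrix (ZMod N) (ZMod N) B}
    (ha : IsAnyonicUnitary ω a) (hb : IsAnyonicUnitary ω b)
    (hab : ∀ i j k l, star (a i j) * star (b k l) =
      chi ω ((i - j) * (k - l)) • (star (b k l) * star (a i j))) :
    IsAnyonicUnitary ω (a * b) := by
  refine ⟨mul_mem ha.unitary hb.unitary, ?_⟩
  have h : twistConj ω (a * b) = twistConj ω a * twistConj ω b := by
    ext i j
    rw [twistConj_apply, Matrix.mul_apply, Matrix.mul_apply, star_sum, Finset.smul_sum]
    refine Finset.sum_congr rfl fun k _ => ?_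
    rw [twistConj_apply, twistConj_apply, smul_mul_smul_comm, hab, star_mul, smul_smul,
      ← chi_add hω, ← chi_add hω]
    congr 2; ring
  rw [h]
  exact mul_mem ha.unitary_twist hb.unitary_twist

theorem norm_le_one_of_isAnyonicUnitary {C : Type*} [CStarAlgebra C]
    {u : Matrix (ZMod N) (ZMod N) C} (h : IsAnyonicUnitary ω u) (i j : ZMod N) : ‖u i j‖ ≤ 1 := by
  have h₁ : star u * u = 1 := Unitary.star_mul_self_of_mem h.unitary
  have h' := congrFun (congrFun h₁ j) j
  rw [Matrix.mul_apply, Matrix.one_apply_eq] at h'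
  exact norm_le_one_of_sum_star_mul_self (fun k => u k j) h' i

theorem norm_le_one_of_isAnyonicPerm {C : Type*} [CStarAlgebra C]
    {q : Matrix (ZMod N) (ZMod N) C} (h : IsAnyonicPerm ω q) (i j : ZMod N) : ‖q i j‖ ≤ 1 := by
  refine norm_le_one_of_sum_star_mul_self (fun k => q k j) ?_ i
  have h' := h.right_add (-j) j 0
  rw [neg_add_cancel, h.zero_left, if_pos rfl] at h'
  rw [h']
  refine Finset.sum_congr rfl fun k _ => ?_
  rw [h.star_eq, smul_mul_assoc, zero_sub]
  congr 2; ring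

end twist

end Relations

/-! ### The anyonic quantum groups -/

section QuantumGroups

set_option linter.unusedSectionVars false

variable (N : ℕ) [NeZero N] (ω : ℂ)

/-- The matrix of the generators of the free `*`-algebra. -/
def freeMatrix : Matrix (ZMod N) (ZMod N) (FreeStarAlg (ZMod N × ZMod N)) :=
  Matrix.of fun i j => FreeStarAlg.gen (i, j)

variable {N ω}

theorem freeMatrix_map {B : Type*} [Ring B] [StarRing B] [Algebra ℂ B] [StarModule ℂ B]
    (a : Matrix (ZMod N) (ZMod N) B) :
    (freeMatrix N).map (FreeStarAlg.lift fun g : ZMod N × ZMod N => a g.1 g.2) = a :=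
  Matrix.ext fun i j => FreeStarAlg.lift_gen (fun g : ZMod N × ZMod N => a g.1 g.2) (i, j)

variable (N ω)

theorem isBounded_permRelators : IsBoundedPresentation (permRelators ω (freeMatrix N)) :=
  isBoundedPresentation_of_norm_le fun p hp g =>
    norm_le_one_of_isAnyonicPerm ((map_permRelators p.coeHom).mp hp) g.1 g.2

theorem isBounded_unitaryRelators : IsBoundedPresentation (unitaryRelators ω (freeMatrix N)) :=
  isBoundedPresentation_of_norm_le fun p hp g =>
    norm_le_one_of_isAnyonicUnitary ((map_unitaryRelators p.coeHom).mp hp) g.1 g.2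

/-- The `C*`-algebra `C(S_N⁺(R))` of the anyonic quantum permutation group. -/
def CSN : Type := UnivCStar (isBounded_permRelators N ω)

/-- The `C*`-algebra `C(U_N⁺(R))` of the anyonic free unitary quantum group. -/
def CUN : Type := UnivCStar (isBounded_unitaryRelators N ω)

instance : CStarAlgebra (CSN N ω) :=
  inferInstanceAs (CStarAlgebra (UnivCStar (isBounded_permRelators N ω)))

instance : CStarAlgebra (CUN N ω) :=
  inferInstanceAs (CStarAlgebra (UnivCStar (isBounded_unitaryRelators N ω)))

/-- The matrix of the generators `qᵢⱼ` of `C(S_N⁺(R))`. -/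
def qMat : Matrix (ZMod N) (ZMod N) (CSN N ω) :=
  Matrix.of fun i j => UnivCStar.gen (isBounded_permRelators N ω) (i, j)

/-- The matrix of the generators `uᵢⱼ` of `C(U_N⁺(R))`. -/
def uMat : Matrix (ZMod N) (ZMod N) (CUN N ω) :=
  Matrix.of fun i j => UnivCStar.gen (isBounded_unitaryRelators N ω) (i, j)

theorem isAnyonicPerm_qMat : IsAnyonicPerm ω (qMat N ω) :=
  (map_permRelators (UnivCStar.mk (isBounded_permRelators N ω))).mp fun _ hr =>
    UnivCStar.mk_eq_zero _ hr

theorem isAnyonicUnitary_uMat : IsAnyonicUnitary ω (uMat N ω) :=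
  (map_unitaryRelators (UnivCStar.mk (isBounded_unitaryRelators N ω))).mp fun _ hr =>
    UnivCStar.mk_eq_zero _ hr

variable {N ω}

section lift

variable {B : Type*} [CStarAlgebra B]

/-- The universal property of `C(S_N⁺(R))`. -/
def CSN.lift (a : Matrix (ZMod N) (ZMod N) B) (ha : IsAnyonicPerm ω a) : CSN N ω →⋆ₐ[ℂ] B :=
  UnivCStar.lift (isBounded_permRelators N ω) (fun g => a g.1 g.2)
    ((map_permRelators _).mpr (by rwa [freeMatrix_map]))

@[simp]
theorem CSN.lift_qMat (a : Matrix (ZMod N) (ZMod N) B) (ha : IsAnyonicPerm ω a) (i j : ZMod N) :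
    CSN.lift a ha (qMat N ω i j) = a i j :=
  UnivCStar.lift_gen (isBounded_permRelators N ω) (fun g => a g.1 g.2) _ (i, j)

theorem CSN.hom_ext {f g : CSN N ω →⋆ₐ[ℂ] B} (h : ∀ i j, f (qMat N ω i j) = g (qMat N ω i j)) :
    f = g :=
  UnivCStar.hom_ext (isBounded_permRelators N ω) fun x => h x.1 x.2

/-- The universal property of `C(U_N⁺(R))`. -/
def CUN.lift (a : Matrix (ZMod N) (ZMod N) B) (ha : IsAnyonicUnitary ω a) : CUN N ω →⋆ₐ[ℂ] B :=
  UnivCStar.lift (isBounded_unitaryRelators N ω) (fun g => a g.1 g.2)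
    ((map_unitaryRelators _).mpr (by rwa [freeMatrix_map]))

@[simp]
theorem CUN.lift_uMat (a : Matrix (ZMod N) (ZMod N) B) (ha : IsAnyonicUnitary ω a)
    (i j : ZMod N) : CUN.lift a ha (uMat N ω i j) = a i j :=
  UnivCStar.lift_gen (isBounded_unitaryRelators N ω) (fun g => a g.1 g.2) _ (i, j)

theorem CUN.hom_ext {f g : CUN N ω →⋆ₐ[ℂ] B} (h : ∀ i j, f (uMat N ω i j) = g (uMat N ω i j)) :
    f = g :=
  UnivCStar.hom_ext (isBounded_unitaryRelators N ω) fun x => h x.1 x.2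

end lift

section structure_maps

variable (hω : IsPrimitiveRoot ω N)

/-- A family of `*`-homomorphisms defines a `*`-homomorphism to the functions. -/
def homPi {A B I : Type*} [CStarAlgebra A] [CStarAlgebra B] (f : I → (A →⋆ₐ[ℂ] B)) :
    A →⋆ₐ[ℂ] (I → B) where
  toFun a i := f i a
  map_one' := funext fun i => map_one (f i)
  map_mul' a b := funext fun i => map_mul (f i) a b
  map_zero' := funext fun i => map_zero (f i)
  map_add' a b := funext fun i => map_add (f i) a b
  commutes' c := funext fun i => AlgHomClass.commutes (f i) c
  map_star' a := funext fun i => map_star (f i) a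

/-- The automorphism `ρ_t` of `C(S_N⁺(R))`, with `ρ_t(qᵢⱼ) = ω ^ (t (j - i)) qᵢⱼ`. -/
def CSN.act (t : ZMod N) : CSN N ω →⋆ₐ[ℂ] CSN N ω :=
  CSN.lift (Matrix.of fun i j => chi ω (t * (j - i)) • qMat N ω i j)
    ((isAnyonicPerm_qMat N ω).smul hω t)

/-- The automorphism `ρ_t` of `C(U_N⁺(R))`, with `ρ_t(uᵢⱼ) = ω ^ (t (j - i)) uᵢⱼ`. -/
def CUN.act (t : ZMod N) : CUN N ω →⋆ₐ[ℂ] CUN N ω :=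
  CUN.lift (Matrix.of fun i j => chi ω (t * (j - i)) • uMat N ω i j)
    ((isAnyonicUnitary_uMat N ω).smul hω t)

theorem CSN.act_qMat (t i j : ZMod N) :
    CSN.act hω t (qMat N ω i j) = chi ω (t * (j - i)) • qMat N ω i j := by
  rw [CSN.act, CSN.lift_qMat, Matrix.of_apply]

theorem CUN.act_uMat (t i j : ZMod N) :
    CUN.act hω t (uMat N ω i j) = chi ω (t * (j - i)) • uMat N ω i j := by
  rw [CUN.act, CUN.lift_uMat, Matrix.of_apply]

/-- The coaction on `C(S_N⁺(R))`, with `ρ_t(qᵢⱼ) = ω ^ (t (j - i)) qᵢⱼ`. -/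
def ρS : Coaction N (CSN N ω) :=
  Coaction.ofAction (homPi (CSN.act hω))
    (fun x => by
      have h : CSN.act hω 0 = StarAlgHom.id ℂ (CSN N ω) := CSN.hom_ext fun i j => by
        rw [CSN.act_qMat, zero_mul, chi_zero, one_smul]; rfl
      exact congrArg (fun f => f x) h)
    (fun x s t => by
      have h : (CSN.act hω s).comp (CSN.act hω t) = CSN.act hω (s + t) :=
        CSN.hom_ext fun i j => by
          rw [StarAlgHom.comp_apply, CSN.act_qMat, map_smul, CSN.act_qMat, CSN.act_qMat, smul_smul,
            ← chi_add hω, add_mul, add_comm]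
      exact congrArg (fun f => f x) h)

/-- The coaction on `C(U_N⁺(R))`, with `ρ_t(uᵢⱼ) = ω ^ (t (j - i)) uᵢⱼ`. -/
def ρU : Coaction N (CUN N ω) :=
  Coaction.ofAction (homPi (CUN.act hω))
    (fun x => by
      have h : CUN.act hω 0 = StarAlgHom.id ℂ (CUN N ω) := CUN.hom_ext fun i j => by
        rw [CUN.act_uMat, zero_mul, chi_zero, one_smul]; rfl
      exact congrArg (fun f => f x) h)
    (fun x s t => by
      have h : (CUN.act hω s).comp (CUN.act hω t) = CUN.act hω (s + t) :=
        CUN.hom_ext fun i j => by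
          rw [StarAlgHom.comp_apply, CUN.act_uMat, map_smul, CUN.act_uMat, CUN.act_uMat, smul_smul,
            ← chi_add hω, add_mul, add_comm]
      exact congrArg (fun f => f x) h)

theorem isHomogeneous_qMat (i j : ZMod N) :
    IsHomogeneous ω (ρS hω) (j - i) (qMat N ω i j) := fun t => CSN.act_qMat hω t i j

theorem isHomogeneous_uMat (i j : ZMod N) :
    IsHomogeneous ω (ρU hω) (j - i) (uMat N ω i j) := fun t => CUN.act_uMat hω t i j

theorem IsHomogeneous.star (hω : IsPrimitiveRoot ω N)
    {X : Type*} [CStarAlgebra X] {ρ : Coaction N X} {d : ZMod N} {x : X}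
    (h : IsHomogeneous ω ρ d x) : IsHomogeneous ω ρ (-d) (star x) := fun t => by
  rw [map_star, Pi.star_apply, h, star_smul, chi_star hω, mul_neg]

/-- The braided tensor product `C(S_N⁺(R)) ⊠ C(S_N⁺(R))`. -/
abbrev CSN2 : Type _ := BraidedTensor hω (ρS hω) (ρS hω)

/-- The braided tensor product `C(U_N⁺(R)) ⊠ C(U_N⁺(R))`. -/
abbrev CUN2 : Type _ := BraidedTensor hω (ρU hω) (ρU hω)

/-- The comultiplication of `S_N⁺(R)`, with `Δ(qᵢⱼ) = ∑ₖ j₁(qᵢₖ) j₂(qₖⱼ)`. -/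
def ΔS : CSN N ω →⋆ₐ[ℂ] CSN2 hω :=
  CSN.lift ((qMat N ω).map (BraidedTensor.j₁ hω (ρS hω) (ρS hω)) *
      (qMat N ω).map (BraidedTensor.j₂ hω (ρS hω) (ρS hω)))
    (((isAnyonicPerm_qMat N ω).map _).mul hω ((isAnyonicPerm_qMat N ω).map _) fun i j k l =>
      BraidedTensor.j₁_mul_j₂ hω (isHomogeneous_qMat hω i j) (isHomogeneous_qMat hω k l))

/-- The comultiplication of `U_N⁺(R)`, with `Δ(uᵢⱼ) = ∑ₖ j₁(uᵢₖ) j₂(uₖⱼ)`. -/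
def ΔU : CUN N ω →⋆ₐ[ℂ] CUN2 hω :=
  CUN.lift ((uMat N ω).map (BraidedTensor.j₁ hω (ρU hω) (ρU hω)) *
      (uMat N ω).map (BraidedTensor.j₂ hω (ρU hω) (ρU hω)))
    (((isAnyonicUnitary_uMat N ω).map _).mul hω ((isAnyonicUnitary_uMat N ω).map _)
      fun i j k l => by
        have h := BraidedTensor.j₁_mul_j₂ hω ((isHomogeneous_uMat hω i j).star hω)
          ((isHomogeneous_uMat hω k l).star hω)
        rwa [map_star, map_star, neg_sub, neg_sub] at h)

theorem ΔS_qMat (i j : ZMod N) :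
    ΔS hω (qMat N ω i j) = ∑ k, BraidedTensor.j₁ hω (ρS hω) (ρS hω) (qMat N ω i k) *
      BraidedTensor.j₂ hω (ρS hω) (ρS hω) (qMat N ω k j) :=
  CSN.lift_qMat _ _ i j

theorem ΔU_uMat (i j : ZMod N) :
    ΔU hω (uMat N ω i j) = ∑ k, BraidedTensor.j₁ hω (ρU hω) (ρU hω) (uMat N ω i k) *
      BraidedTensor.j₂ hω (ρU hω) (ρU hω) (uMat N ω k j) :=
  CUN.lift_uMat _ _ i j

/-- A `ℤ/N`-equivariant Hopf `*`-homomorphism `φ : C(U_N⁺(R)) → C(S_N⁺(R))`: an equivariant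
morphism with `Δ φ = (φ ⊠ φ) Δ`. -/
def IsHopf (φ : EquivariantHom (ρU hω) (ρS hω)) : Prop :=
  ∀ a, ΔS hω (φ a) = BraidedTensor.map hω φ φ (ΔU hω a)

end structure_maps

end QuantumGroups

end Anyonic

end

open Anyonic

/-! The relations of $C(S_N^+(R))$ already contain unitarity. Put $k=0$ in relation (3) and replace
$i$ by $-i$: the left side becomes $\delta_{ij}$ by (1), and on the right the phase
$\omega^{-l(l-i)}$ together with $q_{-l,-i}$ is exactly $q_{li}^*$ by (2). The result is $\sum_l
q_{li}^*q_{lj}=\delta_{ij}$. Relation (4) with column index $0$ gives $qq^*=1$ in the same way,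
except that a phase $\omega^{j(i-j)}$ is left over. It multiplies $\delta_{ij}$ and is $1$ on the
diagonal (`IsAnyonicPerm.mem_unitary`).

For $\overline q_R$, the phase in its definition cancels the phase in (2), so $(\overline
q_R)_{ij}=q_{-i,-j}$ (`IsAnyonicPerm.twistConj_eq`). Thus $\overline q_R$ is $q$ with its rows and
columns relabelled by the same permutation $i\mapsto -i$, and it is unitary because $q$ is
(`IsAnyonicPerm.isAnyonicUnitary`).

The universal property of $C(U_N^+(R))$ now yields $\phi$ with $\phi(u_{ij})=q_{ij}$. Everything
else about $\phi$ except surjectivity is a comparison of unital $*$-homomorphisms out of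
$C(U_N^+(R))$, and these are determined by their values on the $u_{ij}$. Equivariance holds since
$u_{ij}$ and $q_{ij}$ both have degree $j-i$. Compatibility with the comultiplications holds since
both are given by the same matrix formula. Uniqueness is immediate (`quotientHom`,
`isHopf_quotientHom`).

Surjectivity has an algebraic and an analytic half. The range contains the $*$-algebra generated by
the $q_{ij}$, so it is dense. It is also closed, since elements of the range have preimages of
comparable norm: real and imaginary parts of a preimage are cut down by functional calculus, and a
series of such bounded corrections reaches every limit point of the range
(`surjective_of_denseRange`). -/

namespace Anyonic

/-! ### Closed range of `*`-homomorphisms between `C*`-algebras -/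

section DenseRange

variable {A B : Type*} [CStarAlgebra A] [CStarAlgebra B]

/-- Self-adjoint elements in the range of a `*`-homomorphism of `C*`-algebras lift without
increasing the norm. -/
theorem exists_norm_le_of_isSelfAdjoint (f : A →⋆ₐ[ℂ] B) (a : A) (hb : IsSelfAdjoint (f a)) :
    ∃ a', f a' = f a ∧ ‖a'‖ ≤ ‖f a‖ := by
  -- Functional calculus needs a self-adjoint preimage, and `a` need not be one. Its real part is,
  -- and it has the same image because `f a` equals its own real part.
  let s : A := ((realPart a : selfAdjoint A) : A)
  have hs : IsSelfAdjoint s := (realPart a).2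
  have hfs : f s = f a := by
    have h : f s = ((realPart (f a) : selfAdjoint B) : B) := by
      -- The factor 1/2 in the real part is a real scalar, while `f` commutes with complex ones, so
      -- it is recast as a complex scalar first.
      simp only [s, realPart_apply_coe, ← Complex.coe_smul, map_smul, map_add, map_star]
    rw [h, hb.coe_realPart]
  let r : ℝ := ‖f a‖
  -- Truncation to the interval `[-r, r]`. It bounds the norm of `cfc g s` by `r` whatever the
  -- spectrum of `s` is, and it does not affect the image, because the spectrum of `f a` already
  -- lies in that interval.
  let g : ℝ → ℝ := fun x => max (-r) (min x r)
  have hg : Continuous g := by fun_prop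
  have hr : 0 ≤ r := norm_nonneg _
  refine ⟨cfc g s, ?_, norm_cfc_le hr fun x _ => ?_⟩
  · have hsb : IsSelfAdjoint (f s) := hfs ▸ hb
    -- Functional calculus commutes with `f`, so the image of `cfc g s` is `g` applied to `f a`. It
    -- remains to see that `g` is the identity on the spectrum of `f a`.
    rw [StarAlgHomClass.map_cfc f g s hg.continuousOn (continuous_starAlgHom f) hs hsb, hfs]
    conv_rhs => rw [← cfc_id ℝ (f a)]
    refine cfc_congr fun x hx => ?_
    have hx' : ‖x‖ ≤ r := by
      have := norm_apply_le_norm_cfc (fun x : ℝ => x) (f a) hx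
      rwa [cfc_id' ℝ (f a)] at this
    have := abs_le.mp hx'
    simp only [g, id_eq, min_eq_left this.2, max_eq_right this.1]
  · exact abs_le.mpr ⟨le_max_left _ _, max_le (by linarith) (min_le_right _ _)⟩

/-- Elements in the range of a `*`-homomorphism of `C*`-algebras lift with at most twice their
norm. -/
theorem exists_norm_le_two_mul (f : A →⋆ₐ[ℂ] B) (a : A) :
    ∃ a', f a' = f a ∧ ‖a'‖ ≤ 2 * ‖f a‖ := by
  have hre : f ((realPart a : selfAdjoint A) : A) = ((realPart (f a) : selfAdjoint B) : B) := by
    simp only [realPart_apply_coe, ← Complex.coe_smul, map_smul, map_add, map_star]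
  have him : f ((imaginaryPart a : selfAdjoint A) : A) =
      ((imaginaryPart (f a) : selfAdjoint B) : B) := by
    simp only [imaginaryPart_apply_coe, ← Complex.coe_smul, map_smul, map_sub, map_star]
  -- The two self-adjoint parts of `a` are lifted separately. Linearity of `f` over ℂ then lets the
  -- lifts be recombined as `x + i y`.
  obtain ⟨x, hx, hx'⟩ := exists_norm_le_of_isSelfAdjoint f _ (hre ▸ (realPart (f a)).2)
  obtain ⟨y, hy, hy'⟩ := exists_norm_le_of_isSelfAdjoint f _ (him ▸ (imaginaryPart (f a)).2)
  refine ⟨x + Complex.I • y, ?_, ?_⟩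
  · rw [map_add, map_smul, hx, hy, hre, him, realPart_add_I_smul_imaginaryPart]
  · rw [hre] at hx'
    rw [him] at hy'
    have h₁ : ‖((realPart (f a) : selfAdjoint B) : B)‖ ≤ ‖f a‖ := realPart.norm_le (f a)
    have h₂ : ‖((imaginaryPart (f a) : selfAdjoint B) : B)‖ ≤ ‖f a‖ := imaginaryPart.norm_le (f a)
    -- The factor 2 counts the two parts: each lift is bounded by the norm of its part of `f a`, and
    -- that by the norm of `f a`.
    calc ‖x + Complex.I • y‖ ≤ ‖x‖ + ‖Complex.I • y‖ := norm_add_le _ _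
      _ = ‖x‖ + ‖y‖ := by rw [norm_smul, Complex.norm_I, one_mul]
      _ ≤ 2 * ‖f a‖ := by linarith

/-- A `*`-homomorphism of `C*`-algebras with dense range is surjective. -/
theorem surjective_of_denseRange (f : A →⋆ₐ[ℂ] B) (hf : DenseRange f) :
    Function.Surjective f := by
  -- Only the additive structure and the norms matter for the successive approximation, so `f` is
  -- viewed as a bounded homomorphism of normed groups, with bound 1 by contractivity.
  let F : NormedAddGroupHom A B :=
    { toFun := f
      map_add' := map_add f
      bound' := ⟨1, fun x => by rw [one_mul]; exact NonUnitalStarAlgHom.norm_apply_le f x⟩ }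
  have hF : F.SurjectiveOnWith F.range 2 := by
    rintro _ ⟨a, rfl⟩
    exact exists_norm_le_two_mul f a
  intro b
  have hb : b ∈ F.range.topologicalClosure := hf b
  -- Norm-controlled lifting on the range passes to its closure because `A` is complete: a limit
  -- point is the image of a convergent series of lifts. This costs an arbitrary positive increase
  -- of the constant 2, here taken to be 1. The norm bound on `a` is then discarded.
  obtain ⟨a, ha, -⟩ := controlled_closure_of_complete two_pos one_pos hF b hb
  exact ⟨a, ha⟩

end DenseRange

/-! ### Unitarity of anyonic permutation matrices -/

section Perm

variable {N : ℕ} [NeZero N] {ω : ℂ} {B : Type*} [Ring B] [StarRing B] [Algebra ℂ B]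
  {q : Matrix (ZMod N) (ZMod N) B}

/-- An anyonic permutation matrix is unitary. -/
theorem IsAnyonicPerm.mem_unitary (hω : IsPrimitiveRoot ω N) (h : IsAnyonicPerm ω q) :
    q ∈ unitary (Matrix (ZMod N) (ZMod N) B) := by
  refine Unitary.mem_iff.mpr ⟨Matrix.ext fun i j => ?_, Matrix.ext fun i j => ?_⟩
  -- The row index 0 turns the left side into a Kronecker delta, and the column `-i` is the one that
  -- the star relation produces from `star (q k i)`. The phases of the two relations then agree
  -- exactly.
  · have h' := h.right_add (-i) j 0
    rw [h.zero_left] at h'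
    rw [Matrix.mul_apply, Matrix.one_apply]
    have hij : (-i + j = 0) = (i = j) := by rw [neg_add_eq_zero]
    simp only [hij] at h'
    rw [h']
    refine Finset.sum_congr rfl fun k _ => ?_
    rw [Matrix.star_apply, h.star_eq, smul_mul_assoc, zero_sub]
    congr 2; ring
  -- The mirror choice: column index 0 and row `-j`, so that the second factor becomes a multiple of
  -- `star (q j k)`.
  · have h' := h.left_add (-j) i 0
    rw [h.zero_right] at h'
    have hij : (-j + i = 0) = (i = j) := by rw [neg_add_eq_zero, @eq_comm _ j]
    simp only [hij] at h'
    rw [Matrix.mul_apply, Matrix.one_apply]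
    -- Here the phases differ by the factor `chi ω (j * (i - j))`, which does not depend on the
    -- summation index. The Kronecker delta absorbs it, since it equals 1 when `i = j`.
    have h₁ : (if i = j then (1 : B) else 0) =
        chi ω (j * (i - j)) • if i = j then (1 : B) else 0 := by
      split_ifs with hi
      · rw [hi, sub_self, mul_zero, chi_zero, one_smul]
      · rw [smul_zero]
    rw [h₁, h', Finset.smul_sum]
    refine Finset.sum_congr rfl fun k _ => ?_
    rw [Matrix.star_apply, h.star_eq, mul_smul_comm, smul_smul, ← chi_add hω, zero_sub]
    congr 2; ring

/-- The twisted conjugate of an anyonic permutation matrix has the entries `q₋ᵢ,₋ⱼ`. -/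
theorem IsAnyonicPerm.twistConj_eq (hω : IsPrimitiveRoot ω N) (h : IsAnyonicPerm ω q) :
    twistConj ω q = q.submatrix (Equiv.neg (ZMod N)) (Equiv.neg (ZMod N)) := by
  ext i j
  -- The exponent in the definition of the twisted conjugate is opposite to the exponent in the star
  -- relation.
  have h₀ : -(i * (j - i)) + -(i * (i - j)) = 0 := by ring
  rw [twistConj_apply, h.star_eq, smul_smul, ← chi_add hω, h₀, chi_zero, one_smul,
    Matrix.submatrix_apply]
  rfl

/-- Relabelling rows and columns by one and the same permutation respects products, adjoints and the
identity matrix, so the twisted conjugate inherits unitarity from `q`. This is the input that the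
universal property of $C(U_N^+(R))$ requires. -/
theorem IsAnyonicPerm.isAnyonicUnitary (hω : IsPrimitiveRoot ω N) (h : IsAnyonicPerm ω q) :
    IsAnyonicUnitary ω q := by
  have hq := h.mem_unitary hω
  refine ⟨hq, ?_⟩
  rw [h.twistConj_eq hω]
  refine Unitary.mem_iff.mpr ⟨?_, ?_⟩
  · rw [Matrix.star_eq_conjTranspose, Matrix.conjTranspose_submatrix, Matrix.submatrix_mul_equiv,
      ← Matrix.star_eq_conjTranspose, Unitary.star_mul_self_of_mem hq, Matrix.submatrix_one_equiv]
  · rw [Matrix.star_eq_conjTranspose, Matrix.conjTranspose_submatrix, Matrix.submatrix_mul_equiv,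
      ← Matrix.star_eq_conjTranspose, Unitary.mul_star_self_of_mem hq, Matrix.submatrix_one_equiv]

end Perm

theorem EquivariantHom.ext {N : ℕ} [NeZero N] {X Y : Type*} [CStarAlgebra X] [CStarAlgebra Y]
    {ρX : Coaction N X} {ρY : Coaction N Y} {φ ψ : EquivariantHom ρX ρY}
    (h : φ.toStarAlgHom = ψ.toStarAlgHom) : φ = ψ := by
  cases φ; cases ψ; congr

/-! ### The equivariant Hopf `*`-homomorphism and its range -/

section QuotientMap

variable {N : ℕ} [NeZero N] {ω : ℂ} (hω : IsPrimitiveRoot ω N)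

/-- The equivariant morphism `C(U_N⁺(R)) → C(S_N⁺(R))` with `uᵢⱼ ↦ qᵢⱼ`. -/
noncomputable def quotientHom : EquivariantHom (ρU hω) (ρS hω) where
  toStarAlgHom := CUN.lift (qMat N ω) ((isAnyonicPerm_qMat N ω).isAnyonicUnitary hω)
  equivariant x t := by
    -- For fixed `t` both sides of the equivariance condition are `*`-homomorphisms in `x`, so it
    -- suffices to compare them on the generators, where both give `chi ω (t * (j - i)) • qMat N ω i
    -- j`.
    have h : (CSN.act hω t).comp
          (CUN.lift (qMat N ω) ((isAnyonicPerm_qMat N ω).isAnyonicUnitary hω)) =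
        (CUN.lift (qMat N ω) ((isAnyonicPerm_qMat N ω).isAnyonicUnitary hω)).comp
          (CUN.act hω t) :=
      CUN.hom_ext fun i j => by
        rw [StarAlgHom.comp_apply, StarAlgHom.comp_apply, CUN.lift_uMat, CSN.act_qMat,
          CUN.act_uMat, map_smul, CUN.lift_uMat]
    exact congrArg (fun f => f x) h

theorem quotientHom_uMat (i j : ZMod N) : quotientHom hω (uMat N ω i j) = qMat N ω i j :=
  CUN.lift_uMat (qMat N ω) ((isAnyonicPerm_qMat N ω).isAnyonicUnitary hω) i j

/-- Both sides are `*`-homomorphisms on $C(U_N^+(R))$, so the generators decide. The braided product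
of the morphism with itself acts on each leg separately, and both sides send $u_{ij}$ to $\sum_k
j_1(q_{ik})j_2(q_{kj})$. -/
theorem isHopf_quotientHom : IsHopf hω (quotientHom hω) := fun a => by
  have h : (ΔS hω).comp (quotientHom hω).toStarAlgHom =
      (BraidedTensor.map hω (quotientHom hω) (quotientHom hω)).comp (ΔU hω) :=
    CUN.hom_ext fun i j => by
      rw [StarAlgHom.comp_apply, StarAlgHom.comp_apply, quotientHom_uMat, ΔS_qMat, ΔU_uMat,
        map_sum]
      refine Finset.sum_congr rfl fun k _ => ?_
      rw [map_mul, BraidedTensor.map_j₁, BraidedTensor.map_j₂, quotientHom_uMat,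
        quotientHom_uMat]
  exact congrArg (fun f => f a) h

/-- Both `C*`-algebras are completions of quotients of one free `*`-algebra, and `φ` intertwines the
two canonical maps from it because it matches generators. Its range therefore contains a dense
subset, and dense range suffices. -/
theorem CSN.surjective_of_uMat (φ : CUN N ω →⋆ₐ[ℂ] CSN N ω)
    (h : ∀ i j, φ (uMat N ω i j) = qMat N ω i j) : Function.Surjective φ := by
  refine surjective_of_denseRange φ ?_
  have h₁ : φ.comp (UnivCStar.mk (isBounded_unitaryRelators N ω)) =
      UnivCStar.mk (isBounded_permRelators N ω) :=
    FreeStarAlg.hom_ext fun g => h g.1 g.2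
  refine (UnivCStar.dense_mk (isBounded_permRelators N ω)).mono ?_
  rintro _ ⟨a, rfl⟩
  exact ⟨_, congrArg (fun f => f a) h₁⟩

end QuotientMap

end Anyonic

/-! ### The quantum subgroup theorem -/

theorem theorem2 (N : ℕ) [NeZero N] (ω : ℂ) (hω : IsPrimitiveRoot ω N) :
    -- the matrices `q` and `(ω ^ (-i (j - i)) qᵢⱼ*)` are unitary
    qMat N ω ∈ unitary (Matrix (ZMod N) (ZMod N) (CSN N ω)) ∧
    twistConj ω (qMat N ω) ∈ unitary (Matrix (ZMod N) (ZMod N) (CSN N ω)) ∧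
    -- there is a unique equivariant Hopf `*`-homomorphism with `φ(uᵢⱼ) = qᵢⱼ`
    (∃! φ : EquivariantHom (ρU hω) (ρS hω),
      IsHopf hω φ ∧ ∀ i j, φ (uMat N ω i j) = qMat N ω i j) ∧
    -- this homomorphism is surjective, so that it exhibits a quantum subgroup
    (∀ φ : EquivariantHom (ρU hω) (ρS hω),
      IsHopf hω φ → (∀ i j, φ (uMat N ω i j) = qMat N ω i j) → Function.Surjective φ) := by
  have hq := (isAnyonicPerm_qMat N ω).isAnyonicUnitary hω
  refine ⟨hq.unitary, hq.unitary_twist, ⟨quotientHom hω, ⟨isHopf_quotientHom hω,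
    quotientHom_uMat hω⟩, fun ψ hψ => EquivariantHom.ext (CUN.hom_ext fun i j => ?_)⟩,
    fun φ _ h => CSN.surjective_of_uMat φ.toStarAlgHom h⟩
  -- Uniqueness: any competitor `ψ` takes the same values $q_{ij}$ on the generators as the morphism
  -- constructed above.
  exact (hψ.2 i j).trans (quotientHom_uMat hω i j).symm
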